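/- **Setting.** A (finite-horizon) Dec-POMDP $D$ consists of agents $\mathcal N=\{1,\dots,N\}$, a finite set $\mathcal S$ of states, finite sets $\mathcal A_i$, $\mathcal O_i$ of actions and observations of agent $i$ (with $\mathcal A=\prod_i\mathcal A_i$, $\mathcal O=\prod_i\mathcal O_i$), transition probabilities $P(s'\mid s,a)$, a reward $\mathcal R(s,a)\in\mathbb R$, observation probabilities $O(o\mid s,a)$, an initial distribution $b_0$ on $\mathcal S$ and a horizon $T$. At each step $t=0,\dots,T$, agent $i$ draws $A_{i,t}\sim\pi_i(\cdot\mid\tau_{i,t})$, where $\tau_{i,t}=(A_{i,0},O_{i,1},\dots,A_{i,t-1},O_{i,t})$ is its action-observation history; then $S_{t+1}\sim P(\cdot\mid S_t,A_t)$ and $O_{t+1}\sim O(\cdot\mid S_{t+1},A_t)$. Let $\Pi^D$ be the set of joint (stochastic) policies $\pi=(\pi_i)_i$ with its Borel $\sigma$-algebra, $\Delta(\Pi^D)$ the set of probability measures on it, and $J^D(\pi)=\mathbb E_\pi\big[\sum_{t=0}^T\mathcal R(S_t,A_t)\big]$. An isomorphism $f\in\mathrm{Iso}(D,E)$ of Dec-POMDPs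 with equal horizons is a tuple of bijections $f_N:\mathcal N^D\to\mathcal N^E$, $f_S:\mathcal S^D\to\mathcal S^E$, $f_{A_i}:\mathcal A_i^D\to\mathcal A^E_{f_N(i)}$, $f_{O_i}:\mathcal O_i^D\to\mathcal O^E_{f_N(i)}$ that preserves $P,O,\mathcal R,b_0$; $\mathrm{Aut}(D)=\mathrm{Iso}(D,D)$. The pushforward $f^*\pi\in\Pi^E$ is $(f^*\pi)_j(a\mid\tau)=\pi_{f^{-1}j}(f^{-1}a\mid f^{-1}\tau)$. For $g\in\mathrm{Aut}(D)^{\mathcal N}$ let $(g^*\pi)_i=(g_i^*\pi)_i$. The other-play (OP) value of $\pi$ is $J^D_{\mathrm{OP}}(\pi)=\mathbb E_{g}[J^D(g^*\pi)]$ with $g$ uniform on $\mathrm{Aut}(D)^{\mathcal N}$, and $\pi$ is OP-optimal if it maximizes $J^D_{\mathrm{OP}}$ over $\Pi^D$. Let $\mu$ be the law of $g^*\pi$, and $\mu_i$ its marginals. The symmetrizer $\Psi^D(\pi)$ is the joint policy for which $\Psi^D(\pi)_i(a\mid\tau)$ is the conditional probability that agent $i$ plays $a$ given that its history is $\tau$,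 when its local policy is drawn at the start from $\mu_i$ and those of the other agents independently from any distributions under which $\tau$ has positive probability ($1/|\mathcal A_i|$ if there are none). Write $[\pi]=\{\pi':\Psi^D(\pi')=\Psi^D(\pi)\}$ and $f^*[\pi]=[f^*\pi]$ for $f\in\mathrm{Iso}(D,E)$. A labeling of $D$ is a tuple of bijections from $\mathcal N,\mathcal S,\mathcal A_i,\mathcal O_i$ onto $\{1,\dots,k\}$ with the respective $k$; transporting $D$ along it gives a relabeled problem, and $\mathcal D$ is the (finite) set of all relabeled problems of $D$. A learning algorithm $\sigma$ assigns to each $E\in\mathcal D$ some $\sigma(E)\in\Delta(\Pi^E)$. It is an OP learning algorithm if $\mathbb E_{\pi\sim\sigma(E)}[J^E_{\mathrm{OP}}(\pi)]=\max_{\Pi^E}J^E_{\mathrm{OP}}$ for all $E\in\mathcal D$. Its value in the label-free coordination (LFC) problem for $D$ is $$U^D(\sigma)=\mathbb E\big[J^D\big((\pi^{(k)}_k)_{k\in\mathcal N}\big)\big],$$ where, independently for $k\in\mathcal N$, $D_k$ is uniform on $\mathcal D$, $f_k$ is uniform on $\mathrm{Iso}(D_k,D)$, and $\pi^{(k)}=f_k^*\rho$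 with $\rho\sim\sigma(D_k)$; $\sigma$ is optimal in the LFC problem if it maximizes $U^D$ over all learning algorithms. **The game.** From now on $D$ is the two-stage lever game: two agents, one state, $\mathcal A_i=\mathcal O_i=\{1,2\}$, $T=1$ (two rounds), reward $1$ if both agents pull the same lever and $-1$ otherwise, and in the second round each agent observes the other agent's first action. In both policies $\pi^R$ and $\pi^S$ each agent chooses uniformly in the first round, and also in the second round if the first actions differed; if the first actions agreed, each agent repeats its action under $\pi^R$ and switches to the other action under $\pi^S$. For each $E\in\mathcal D$ fix any $f_{D,E}\in\mathrm{Iso}(D,E)$. Say that $\sigma$ *learns both $[\pi^R]$ and $[\pi^S]$* if for every $E\in\mathcal D$ there are $\alpha_E\in[0,1]$ and $\mu^E,\mu'^E\in\Delta(\Pi^E)$ with $\sigma(E)=\alpha_E\mu^E+(1-\alpha_E)\mu'^E$ and $\mu^E(f_{D,E}^*[\pi^R])=1=\mu'^E(f_{D,E}^*[\pi^S])$, such that $\alpha_{E}>0$ for some $E\in\mathcal D$ and $\alpha_{E'}<1$ for some (possibly different) $E'\in\mathcal D$. **Theorem.** (1) The OP-optimal policies of the two-stage lever game form exactly two classes: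 $[\pi^R]\neq[\pi^S]$, a policy is OP-optimal if and only if it lies in $[\pi^R]\cup[\pi^S]$, and all these policies have OP value $\tfrac12$. (2) $J^D(\pi^R_1,\pi^S_2)=J^D(\pi^S_1,\pi^R_2)=-\tfrac12$. (3) Every learning algorithm $\sigma$ that learns both $[\pi^R]$ and $[\pi^S]$ is an OP learning algorithm, satisfies $U^D(\sigma)<\tfrac12$, and is not optimal in the LFC problem for $D$. -/

import Mathlib

open MeasureTheory
open scoped BigOperators

noncomputable section

/-- Finite-horizon decentralized partially observable Markov decision problem, with agents
`Fin N`, finite sets of states, of actions and of observations, and horizon `T`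
(the time steps are `0, …, T`). Probability distributions on a finite set `X` are points of
`stdSimplex ℝ X`. -/
structure DecPOMDP : Type 1 where
  N : ℕ
  State : Type
  Act : Fin N → Type
  Obs : Fin N → Type
  [fintypeState : Fintype State]
  [fintypeAct : ∀ i, Fintype (Act i)]
  [fintypeObs : ∀ i, Fintype (Obs i)]
  /-- `trans s a s'` is the probability `P(s' ∣ s, a)`. -/
  trans : State → (∀ i, Act i) → stdSimplex ℝ State
  reward : State → (∀ i, Act i) → ℝ
  /-- `obsKer s a o` is the probability `O(o ∣ s, a)` of the joint observation `o` in the new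
  state `s` after the joint action `a`. -/
  obsKer : State → (∀ i, Act i) → stdSimplex ℝ (∀ i, Obs i)
  init : stdSimplex ℝ State
  T : ℕ

attribute [instance] DecPOMDP.fintypeState DecPOMDP.fintypeAct DecPOMDP.fintypeObs

/-- Transport of a distribution along a bijection: `(relabelDist e p) y = p (e⁻¹ y)`. -/
def relabelDist {X Y : Type} [Fintype X] [Fintype Y] (e : X ≃ Y) (p : stdSimplex ℝ X) :
    stdSimplex ℝ Y :=
  ⟨fun y => p (e.symm y), fun y => p.2.1 (e.symm y), by
    rw [← p.2.2]; exact Equiv.sum_comp e.symm (fun x => p x)⟩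

/-- The distribution concentrated on `x`. -/
def pointDist {X : Type} [Fintype X] [DecidableEq X] (x : X) : stdSimplex ℝ X :=
  ⟨Pi.single x 1, single_mem_stdSimplex ℝ x⟩

namespace DecPOMDP

/-! ### Histories, policies, expected return -/

/-- Local action-observation histories of agent `i`: a length `t ≤ T` together with the pairs
`(A_{i,k}, O_{i,k+1})` for `k < t`. -/
abbrev AOHist (D : DecPOMDP) (i : Fin D.N) : Type :=
  Σ t : Fin (D.T + 1), (Fin (t : ℕ) → D.Act i × D.Obs i)

/-- Local stochastic policies of agent `i`; they carry the product (that is, Borel) σ-algebra. -/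
abbrev LocalPolicy (D : DecPOMDP) (i : Fin D.N) : Type :=
  D.AOHist i → stdSimplex ℝ (D.Act i)

/-- Joint policies. -/
abbrev Policy (D : DecPOMDP) : Type := ∀ i, D.LocalPolicy i

/-- Entire histories: states at times `0, …, T`, joint actions at times `0, …, T`, and joint
observations at times `1, …, T` (the entry `k : Fin T` is the observation at time `k + 1`).
Rewards are functions of these. -/
abbrev History (D : DecPOMDP) : Type :=
  (Fin (D.T + 1) → D.State) × (Fin (D.T + 1) → ∀ i, D.Act i) × (Fin D.T → ∀ i, D.Obs i)

def History.state {D : DecPOMDP} (h : D.History) (t : Fin (D.T + 1)) : D.State := h.1 t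

def History.act {D : DecPOMDP} (h : D.History) (t : Fin (D.T + 1)) : ∀ i, D.Act i := h.2.1 t

/-- `h.obs k` is the joint observation at time `k + 1`. -/
def History.obs {D : DecPOMDP} (h : D.History) (k : Fin D.T) : ∀ i, D.Obs i := h.2.2 k

/-- The action-observation history of agent `i` at time `t`. -/
def History.aoHist {D : DecPOMDP} (h : D.History) (i : Fin D.N) (t : Fin (D.T + 1)) :
    D.AOHist i :=
  ⟨t, fun k => (h.act ⟨k, by omega⟩ i, h.obs ⟨k, by omega⟩ i)⟩

/-- The probability of the entire history `h` when the agents follow the joint policy `π`. -/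
def histProb (D : DecPOMDP) (π : D.Policy) (h : D.History) : ℝ :=
  D.init (h.state 0)
    * (∏ t : Fin D.T, D.trans (h.state t.castSucc) (h.act t.castSucc) (h.state t.succ)
        * D.obsKer (h.state t.succ) (h.act t.castSucc) (h.obs t))
    * ∏ t : Fin (D.T + 1), ∏ i, π i (h.aoHist i t) (h.act t i)

/-- The self-play objective: the expected total reward of the joint policy `π`. -/
def J (D : DecPOMDP) (π : D.Policy) : ℝ :=
  ∑ h : D.History, D.histProb π h * ∑ t, D.reward (h.state t) (h.act t)

/-! ### Isomorphisms and pushforward -/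

/-- Isomorphisms of Dec-POMDPs. The joint action `Equiv.piCongr fN fA a` is the one in which
agent `fN i` plays `fA i (a i)`; likewise for joint observations. -/
structure Iso (D E : DecPOMDP) where
  fN : Fin D.N ≃ Fin E.N
  fS : D.State ≃ E.State
  fA : ∀ i, D.Act i ≃ E.Act (fN i)
  fO : ∀ i, D.Obs i ≃ E.Obs (fN i)
  horizon : D.T = E.T
  trans_eq : ∀ s a s', D.trans s a s' = E.trans (fS s) (Equiv.piCongr fN fA a) (fS s')
  obs_eq : ∀ s a o,
    D.obsKer s a o = E.obsKer (fS s) (Equiv.piCongr fN fA a) (Equiv.piCongr fN fO o)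
  reward_eq : ∀ s a, D.reward s a = E.reward (fS s) (Equiv.piCongr fN fA a)
  init_eq : ∀ s, D.init s = E.init (fS s)

/-- Automorphisms. -/
abbrev Aut (D : DecPOMDP) : Type := Iso D D

instance (D E : DecPOMDP) : Finite (Iso D E) := by
  let F : Iso D E → Σ fN : Fin D.N ≃ Fin E.N, (D.State ≃ E.State) ×
      (∀ i, D.Act i ≃ E.Act (fN i)) × (∀ i, D.Obs i ≃ E.Obs (fN i)) :=
    fun f => ⟨f.fN, f.fS, f.fA, f.fO⟩
  refine Finite.of_injective F ?_
  rintro ⟨a, b, c, d, _, _, _, _, _⟩ ⟨a', b', c', d', _, _, _, _, _⟩ h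
  simp only [F, Sigma.mk.injEq] at h
  obtain ⟨rfl, h⟩ := h
  simp only [heq_eq_eq, Prod.mk.injEq] at h
  obtain ⟨rfl, rfl, rfl⟩ := h
  rfl

instance (D E : DecPOMDP) : Fintype (Iso D E) := Fintype.ofFinite _

/-- Element-wise application of `f⁻¹` to an action-observation history of agent `f i`. -/
def Iso.invHist {D E : DecPOMDP} (f : Iso D E) (i : Fin D.N) (τ : E.AOHist (f.fN i)) :
    D.AOHist i :=
  ⟨Fin.cast (by rw [f.horizon]) τ.1,
    fun k => ((f.fA i).symm (τ.2 k).1, (f.fO i).symm (τ.2 k).2)⟩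

/-- The pushforward policy `f^*π`: for `j = f i`,
`(f^*π)_j (a ∣ τ) = π_i (f⁻¹ a ∣ f⁻¹ τ)`. -/
def Iso.push {D E : DecPOMDP} (f : Iso D E) (π : D.Policy) : E.Policy :=
  Equiv.piCongrLeft E.LocalPolicy f.fN
    (fun i τ => relabelDist (f.fA i) (π i (f.invHist i τ)))

/-! ### Other-play -/

/-- For a profile `g` of automorphisms, the joint policy in which agent `i` uses its local policy
in the pushforward of `π` by `g i`. -/
def pushProfile (D : DecPOMDP) (g : Fin D.N → D.Aut) (π : D.Policy) : D.Policy :=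
  fun i => (g i).push π i

/-- The other-play objective (`𝔼` is the average over the uniform distribution). -/
def JOP (D : DecPOMDP) (π : D.Policy) : ℝ :=
  𝔼 g : Fin D.N → D.Aut, D.J (D.pushProfile g π)

/-- OP-optimal policies: the maximizers of the other-play objective. -/
def IsOPOptimal (D : DecPOMDP) (π : D.Policy) : Prop :=
  ∀ π' : D.Policy, D.JOP π' ≤ D.JOP π

/-- Probability of a set of histories under `π`. -/
def prob (D : DecPOMDP) (π : D.Policy) (Q : Set D.History) : ℝ :=
  ∑ h : D.History, Q.indicator (D.histProb π) h

/-- Probability of a set of histories when a joint policy is first sampled from `μ`. -/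
def mixProb (D : DecPOMDP) (μ : Measure D.Policy) (Q : Set D.History) : ℝ :=
  ∫ π, D.prob π Q ∂μ

/-- The event that agent `i` has action-observation history `τ` (at the time given by the
length of `τ`). -/
def reach (D : DecPOMDP) (i : Fin D.N) (τ : D.AOHist i) : Set D.History :=
  {h | h.aoHist i τ.1 = τ}

/-- The event that agent `i` plays `a` at the time given by the length of `τ`. -/
def plays (D : DecPOMDP) (i : Fin D.N) (τ : D.AOHist i) (a : D.Act i) : Set D.History :=
  {h | h.act τ.1 i = a}

/-- A choice of independent distributions over the local policies of all agents, the one of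
agent `i` being `μ`, under which agent `i` has history `τ` with positive probability. -/
def Witness (D : DecPOMDP) (i : Fin D.N) (μ : Measure (D.LocalPolicy i)) (τ : D.AOHist i)
    (ν : ∀ j, ProbabilityMeasure (D.LocalPolicy j)) : Prop :=
  (ν i : Measure (D.LocalPolicy i)) = μ ∧
    0 < D.mixProb (Measure.pi fun j => (ν j : Measure (D.LocalPolicy j))) (D.reach i τ)

open Classical in
/-- The action probabilities of the local policy of agent `i` corresponding to a distribution `μ`
over its local policies: the conditional probability of playing `a` given the history `τ`,
for any choice of independent distributions over the other agents' policies that makes `τ`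
possible, and uniform if there is none. -/
def mixturePolicy (D : DecPOMDP) (i : Fin D.N) (μ : Measure (D.LocalPolicy i))
    (τ : D.AOHist i) (a : D.Act i) : ℝ :=
  if hν : ∃ ν, D.Witness i μ τ ν then
    D.mixProb (Measure.pi fun j => (hν.choose j : Measure (D.LocalPolicy j)))
        (D.plays i τ a ∩ D.reach i τ)
      / D.mixProb (Measure.pi fun j => (hν.choose j : Measure (D.LocalPolicy j))) (D.reach i τ)
  else 1 / Fintype.card (D.Act i)

/-- The other-play distribution of `π`: the uniform mixture of the point masses at the
policies `pushProfile g π`. -/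
def opDist (D : DecPOMDP) (π : D.Policy) : Measure D.Policy :=
  ((Fintype.card D.Aut : ENNReal) ^ D.N)⁻¹ •
    ∑ g : Fin D.N → D.Aut, Measure.dirac (D.pushProfile g π)

/-- The symmetrizer `Ψ`, given by its action probabilities: the policy corresponding to the
marginals of the other-play distribution. -/
def symmetrizer (D : DecPOMDP) (π : D.Policy) (i : Fin D.N) (τ : D.AOHist i) (a : D.Act i) : ℝ :=
  D.mixturePolicy i ((D.opDist π).map fun π' => π' i) τ a

/-- The equivalence class `[π]` of the policies with the same image under the symmetrizer. -/
def opClass (D : DecPOMDP) (π : D.Policy) : Set D.Policy :=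
  {π' | D.symmetrizer π' = D.symmetrizer π}

/-- Pushforward of an equivalence class: `f^*[π] = [f^*π]`. -/
def Iso.pushClass {D E : DecPOMDP} (f : Iso D E) (π : D.Policy) : Set E.Policy :=
  E.opClass (f.push π)

/-! ### Relabeled problems -/

/-- Labelings: bijections from agents, states, actions and observations to the canonical sets of
the same size. -/
structure Labeling (D : DecPOMDP) where
  fN : Fin D.N ≃ Fin D.N
  fS : D.State ≃ Fin (Fintype.card D.State)
  fA : ∀ i, D.Act i ≃ Fin (Fintype.card (D.Act i))
  fO : ∀ i, D.Obs i ≃ Fin (Fintype.card (D.Obs i))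

instance (D : DecPOMDP) : Finite (Labeling D) := by
  let F : Labeling D → (Fin D.N ≃ Fin D.N) × (D.State ≃ Fin (Fintype.card D.State)) ×
      (∀ i, D.Act i ≃ Fin (Fintype.card (D.Act i))) ×
      (∀ i, D.Obs i ≃ Fin (Fintype.card (D.Obs i))) :=
    fun f => ⟨f.fN, f.fS, f.fA, f.fO⟩
  refine Finite.of_injective F ?_
  rintro ⟨a, b, c, d⟩ ⟨a', b', c', d'⟩ h
  simp only [F, Prod.mk.injEq] at h
  obtain ⟨rfl, rfl, rfl, rfl⟩ := h
  rfl

/-- The action of a labeling on joint actions: in the image of `a`, agent `fN i` plays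
`fA i (a i)`. -/
def Labeling.jointAct {D : DecPOMDP} (f : Labeling D) :
    (∀ i, D.Act i) ≃ ∀ j, Fin (Fintype.card (D.Act (f.fN.symm j))) :=
  Equiv.piCongr f.fN fun i => (f.fA i).trans (finCongr (by rw [Equiv.symm_apply_apply]))

/-- The action of a labeling on joint observations. -/
def Labeling.jointObs {D : DecPOMDP} (f : Labeling D) :
    (∀ i, D.Obs i) ≃ ∀ j, Fin (Fintype.card (D.Obs (f.fN.symm j))) :=
  Equiv.piCongr f.fN fun i => (f.fO i).trans (finCongr (by rw [Equiv.symm_apply_apply]))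

/-- The relabeled problem `f^*D`. -/
@[reducible] def relabel (D : DecPOMDP) (f : Labeling D) : DecPOMDP where
  N := D.N
  State := Fin (Fintype.card D.State)
  Act := fun j => Fin (Fintype.card (D.Act (f.fN.symm j)))
  Obs := fun j => Fin (Fintype.card (D.Obs (f.fN.symm j)))
  trans := fun s a => relabelDist f.fS (D.trans (f.fS.symm s) (f.jointAct.symm a))
  reward := fun s a => D.reward (f.fS.symm s) (f.jointAct.symm a)
  obsKer := fun s a => relabelDist f.jointObs (D.obsKer (f.fS.symm s) (f.jointAct.symm a))
  init := relabelDist f.fS D.init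
  T := D.T

/-- The set of all relabeled problems of `D`. -/
def relabelings (D : DecPOMDP) : Set DecPOMDP := Set.range D.relabel

instance (D : DecPOMDP) : Fintype D.relabelings :=
  @Fintype.ofFinite _ (Set.finite_range D.relabel)

/-! ### Learning algorithms and label-free coordination -/

/-- Learning algorithms for a set of Dec-POMDPs. -/
abbrev LearningAlg (C : Set DecPOMDP) : Type 1 :=
  ∀ E : C, ProbabilityMeasure (Policy (E : DecPOMDP))

/-- Other-play learning algorithms: on every problem of `C`, the expected other-play value of
the learned policy is the maximum of the other-play objective. -/
def IsOPAlg {C : Set DecPOMDP} (σ : LearningAlg C) : Prop :=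
  ∀ E : C, IsGreatest (Set.range (JOP (E : DecPOMDP)))
    (∫ π, JOP (E : DecPOMDP) π ∂(σ E : Measure (Policy (E : DecPOMDP))))

/-- Common payoff of the principals in the label-free coordination game for `D`. -/
def lfcPayoff (D : DecPOMDP) (σ : Fin D.N → LearningAlg D.relabelings) : ℝ :=
  𝔼 E : Fin D.N → D.relabelings, 𝔼 f : ∀ j, Iso (E j : DecPOMDP) D,
    ∫ π : Fin D.N → D.Policy, D.J (fun l => π l l)
      ∂(Measure.pi fun k =>
        (σ k (E k) : Measure (Policy (E k : DecPOMDP))).map (f k).push)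

/-- Value of a learning algorithm in the label-free coordination problem for `D`. -/
def lfcValue (D : DecPOMDP) (σ : LearningAlg D.relabelings) : ℝ :=
  D.lfcPayoff fun _ => σ

/-- Optimality in the label-free coordination problem for `D`. -/
def IsLFCOptimal (D : DecPOMDP) (σ : LearningAlg D.relabelings) : Prop :=
  ∀ σ' : LearningAlg D.relabelings, D.lfcValue σ' ≤ D.lfcValue σ

/-- `σ` learns both `[ρ]` and `[ρ']`, where `f E` is a chosen isomorphism from `D` to the relabeled
problem `E`: on each `E`, `σ E` is a mixture, with weights `α E` and `1 - α E`, of a distribution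
concentrated on `(f E)^*[ρ]` and one concentrated on `(f E)^*[ρ']`, and the weight of the first is
positive on some relabeled problem, that of the second on some, possibly different, one. -/
def LearnsBoth (D : DecPOMDP) (ρ ρ' : D.Policy) (f : ∀ E : D.relabelings, Iso D (E : DecPOMDP))
    (σ : LearningAlg D.relabelings) : Prop :=
  ∃ (α : D.relabelings → ℝ) (μ μ' : LearningAlg D.relabelings),
    (∀ E : D.relabelings, α E ∈ Set.Icc (0 : ℝ) 1) ∧
    (∀ E : D.relabelings, (σ E : Measure (Policy (E : DecPOMDP))) =
      ENNReal.ofReal (α E) • (μ E : Measure (Policy (E : DecPOMDP)))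
        + ENNReal.ofReal (1 - α E) • (μ' E : Measure (Policy (E : DecPOMDP)))) ∧
    (∀ E : D.relabelings, (μ E : Measure (Policy (E : DecPOMDP))) ((f E).pushClass ρ) = 1) ∧
    (∀ E : D.relabelings, (μ' E : Measure (Policy (E : DecPOMDP))) ((f E).pushClass ρ') = 1) ∧
    (∃ E : D.relabelings, 0 < α E) ∧ (∃ E : D.relabelings, α E < 1)

end DecPOMDP

/-! ### The two-stage lever game -/

/-- Two agents, one state, two levers, two rounds; the reward is `1` if both agents pull the same
lever and `-1` otherwise, and in the second round each agent observes the other agent's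
previous action. -/
@[reducible] def leverGame : DecPOMDP where
  N := 2
  State := Fin 1
  Act := fun _ => Fin 2
  Obs := fun _ => Fin 2
  trans := fun _ _ => pointDist 0
  reward := fun _ a => if a 0 = a 1 then 1 else -1
  obsKer := fun _ a => pointDist fun i => a i.rev
  init := pointDist 0
  T := 1

/-- The uniform distribution on the two levers. -/
def uniformLever : stdSimplex ℝ (Fin 2) := ⟨fun _ => 1 / 2, fun _ => by norm_num, by norm_num⟩

/-- Both agents randomize uniformly in the first round, and in the second round if their first
actions differed; if these agreed, each plays `r a`, where `a` is the own first action. -/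
def leverPolicy (r : Fin 2 → Fin 2) : leverGame.Policy := fun _ τ =>
  if h : 0 < (τ.1 : ℕ) then
    if (τ.2 ⟨0, h⟩).1 = (τ.2 ⟨0, h⟩).2 then pointDist (r (τ.2 ⟨0, h⟩).1) else uniformLever
  else uniformLever

/-- The policy `π^R`: repeat the first action after successful coordination. -/
def policyR : leverGame.Policy := leverPolicy id

/-- The policy `π^S`: switch to the other action after successful coordination. -/
def policyS : leverGame.Policy := leverPolicy Fin.rev

end

namespace DecPOMDP

/-! ### Composition and inversion of isomorphisms -/

/-! For two independent choices between two levers, the probability of agreeing minus that of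
differing is the product of the two biases. Hence the return is a bilinear form in five numbers per
agent (`J_eq`): the bias of the first action and, for each pair of first actions, the weighted bias
of the second.

The automorphisms of the game are exactly the four pairs of an agent permutation and a lever
permutation (`leverAut_bijective`). Averaging over them kills the first-round bias and leaves only
`repeatBias` and `failBias`, say `r` and `φ`. The other-play value is `2r² - 2φ²` (`JOP_eq`) and
`|r| ≤ 1/2`, so its maximum `1/2` is attained exactly at `r = ±1/2`, `φ = 0`. The symmetrizer plays
`1/2` in the first round and `1/2 ± ` a symmetrized feature in the second, so a class is the same
thing as a pair `(r, φ)` (`push_mem_opClass_push_iff`). The two maximizers are therefore two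
classes, those of `policyR` and `policyS`.

In label-free coordination, averaging over isomorphisms to the game has the same effect as averaging
over automorphisms (`avgFeature_push`), and the symmetrized features of `policyS` are the negatives
of those of `policyR`. With weights `α E` on the first class, the value is half the square of the
mean of `2 * α E - 1` (`lfcValue_of_forall_integral`). That mean lies strictly between `-1` and `1`
if both classes occur, while always learning `policyR` gives `1/2`. -/

theorem piCongr_trans {ι κ l : Type*} {A : ι → Type*} {B : κ → Type*} {C : l → Type*}
    (e : ι ≃ κ) (e' : κ ≃ l) (F : ∀ i, A i ≃ B (e i)) (G : ∀ k, B k ≃ C (e' k)) (a : ∀ i, A i) :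
    Equiv.piCongr (e.trans e') (fun i => (F i).trans (G (e i)) : ∀ i, A i ≃ C (e.trans e' i)) a
      = Equiv.piCongr e' G (Equiv.piCongr e F a) := by
  funext k
  obtain ⟨i, rfl⟩ := (e.trans e').surjective k
  rw [Equiv.piCongr_apply_apply]
  simp only [Equiv.trans_apply]
  rw [Equiv.piCongr_apply_apply, Equiv.piCongr_apply_apply]
  rfl

/-- The inverse of a family of bijections over a bijection of index types. -/
def familySymm {ι κ : Type*} {A : ι → Type*} {B : κ → Type*}
    (e : ι ≃ κ) (F : ∀ i, A i ≃ B (e i)) (k : κ) : B k ≃ A (e.symm k) :=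
  (Equiv.cast (congrArg B (e.apply_symm_apply k).symm)).trans (F (e.symm k)).symm

theorem piCongr_familySymm {ι κ : Type*} {A : ι → Type*} {B : κ → Type*}
    (e : ι ≃ κ) (F : ∀ i, A i ≃ B (e i)) (b : ∀ k, B k) :
    Equiv.piCongr e.symm (familySymm e F) b = (Equiv.piCongr e F).symm b := by
  funext i
  obtain ⟨k, rfl⟩ := e.symm.surjective i
  rw [Equiv.piCongr_apply_apply, Equiv.piCongr_symm_apply]
  -- With the target index a variable, the cast disappears by substitution; it is then used at `e
  -- (e.symm k)`.
  have aux : ∀ (k' : κ) (h : k = k') (h' : B k = B k'), cast h' (b k) = b k' := by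
    rintro k' rfl h'; rfl
  simp only [familySymm, Equiv.trans_apply, Equiv.cast_apply]
  rw [aux _ (e.apply_symm_apply k).symm]

/-- Composition of isomorphisms. -/
def Iso.trans {D E F : DecPOMDP} (f : Iso D E) (h : Iso E F) : Iso D F where
  fN := f.fN.trans h.fN
  fS := f.fS.trans h.fS
  fA i := (f.fA i).trans (h.fA (f.fN i))
  fO i := (f.fO i).trans (h.fO (f.fN i))
  horizon := f.horizon.trans h.horizon
  trans_eq s a s' := by
    rw [f.trans_eq, h.trans_eq, piCongr_trans]; rfl
  obs_eq s a o := by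
    rw [f.obs_eq, h.obs_eq, piCongr_trans, piCongr_trans]; rfl
  reward_eq s a := by
    rw [f.reward_eq, h.reward_eq, piCongr_trans]; rfl
  init_eq s := by rw [f.init_eq, h.init_eq]; rfl

/-- The inverse of an isomorphism. -/
def Iso.symm {D E : DecPOMDP} (f : Iso D E) : Iso E D where
  fN := f.fN.symm
  fS := f.fS.symm
  fA := familySymm f.fN f.fA
  fO := familySymm f.fN f.fO
  horizon := f.horizon.symm
  trans_eq s a s' := by
    rw [f.trans_eq, piCongr_familySymm, Equiv.apply_symm_apply, Equiv.apply_symm_apply,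
      Equiv.apply_symm_apply]
  obs_eq s a o := by
    rw [f.obs_eq, piCongr_familySymm, piCongr_familySymm, Equiv.apply_symm_apply,
      Equiv.apply_symm_apply, Equiv.apply_symm_apply]
  reward_eq s a := by
    rw [f.reward_eq, piCongr_familySymm, Equiv.apply_symm_apply, Equiv.apply_symm_apply]
  init_eq s := by rw [f.init_eq, Equiv.apply_symm_apply]

theorem Iso.trans_left_injective {D E F : DecPOMDP} (f : Iso D E) :
    Function.Injective (fun h : Iso E F => f.trans h) := by
  rintro ⟨a, b, c, d, _, _, _, _, _⟩ ⟨a', b', c', d', _, _, _, _, _⟩ h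
  simp only [Iso.trans, Iso.mk.injEq] at h
  obtain ⟨hN, hS, hA, hO⟩ := h
  have hN' : a = a' := by
    ext j
    obtain ⟨i, rfl⟩ := f.fN.surjective j
    exact congrArg Fin.val (Equiv.congr_fun hN i)
  subst hN'
  have hS' : b = b' := by
    ext j
    obtain ⟨i, rfl⟩ := f.fS.surjective j
    exact Equiv.congr_fun hS i
  have hA' : c = c' := by
    funext j
    obtain ⟨i, rfl⟩ := f.fN.surjective j
    ext x
    obtain ⟨y, rfl⟩ := (f.fA i).surjective x
    exact Equiv.congr_fun (congrFun (eq_of_heq hA) i) y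
  have hO' : d = d' := by
    funext j
    obtain ⟨i, rfl⟩ := f.fN.surjective j
    ext x
    obtain ⟨y, rfl⟩ := (f.fO i).surjective x
    exact Equiv.congr_fun (congrFun (eq_of_heq hO) i) y
  subst hS' hA' hO'
  rfl

theorem Iso.trans_right_injective {D E F : DecPOMDP} (f : Iso E F) :
    Function.Injective (fun h : Iso D E => h.trans f) := by
  rintro ⟨a, b, c, d, _, _, _, _, _⟩ ⟨a', b', c', d', _, _, _, _, _⟩ h
  simp only [Iso.trans, Iso.mk.injEq] at h
  obtain ⟨hN, hS, hA, hO⟩ := h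
  have hN' : a = a' := by
    ext j
    exact congrArg Fin.val (f.fN.injective (Equiv.congr_fun hN j))
  subst hN'
  have hS' : b = b' := by
    ext j
    exact f.fS.injective (Equiv.congr_fun hS j)
  have hA' : c = c' := by
    funext j
    ext x
    exact (f.fA _).injective (Equiv.congr_fun (congrFun (eq_of_heq hA) j) x)
  have hO' : d = d' := by
    funext j
    ext x
    exact (f.fO _).injective (Equiv.congr_fun (congrFun (eq_of_heq hO) j) x)
  subst hS' hA' hO'
  rfl

/-- Composition with `f` and with `f.symm` gives injections in both directions between finite sets,
so the cardinalities agree and injectivity suffices. This allows uniform averages over isomorphisms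
to be reindexed. -/
theorem Iso.trans_left_bijective {D E F : DecPOMDP} (f : Iso D E) :
    Function.Bijective (fun h : Iso E F => f.trans h) :=
  (Fintype.bijective_iff_injective_and_card _).2 ⟨f.trans_left_injective,
    le_antisymm (Fintype.card_le_of_injective _ f.trans_left_injective)
      (Fintype.card_le_of_injective _ f.symm.trans_left_injective)⟩

theorem Iso.trans_right_bijective {D E F : DecPOMDP} (f : Iso E F) :
    Function.Bijective (fun h : Iso D E => h.trans f) :=
  (Fintype.bijective_iff_injective_and_card _).2 ⟨f.trans_right_injective,
    le_antisymm (Fintype.card_le_of_injective _ f.trans_right_injective)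
      (Fintype.card_le_of_injective _ f.symm.trans_right_injective)⟩

/-- Conjugation of automorphisms by an isomorphism. -/
noncomputable def Iso.conj {D E : DecPOMDP} (f : Iso D E) : D.Aut ≃ E.Aut :=
  (Equiv.ofBijective _ f.trans_right_bijective).trans
    (Equiv.ofBijective _ f.trans_left_bijective).symm

/-- The intertwining relation through which an automorphism is carried past `f`; together with
`Iso.push_trans` it yields the invariance of other-play. -/
theorem Iso.trans_conj {D E : DecPOMDP} (f : Iso D E) (g : D.Aut) :
    f.trans (f.conj g) = g.trans f :=
  (Equiv.ofBijective _ f.trans_left_bijective).apply_symm_apply (g.trans f)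

/-! ### Pushforward of local policies -/

theorem measurable_coe_stdSimplex {X : Type} [Fintype X] (x : X) :
    Measurable fun p : stdSimplex ℝ X => p x :=
  (measurable_pi_apply x).comp measurable_subtype_coe

theorem measurable_relabelDist {X Y : Type} [Fintype X] [Fintype Y] (e : X ≃ Y) :
    Measurable (relabelDist e) :=
  Measurable.subtype_mk (measurable_pi_lambda _ fun y => measurable_coe_stdSimplex (e.symm y))

@[simp] theorem relabelDist_apply {X Y : Type} [Fintype X] [Fintype Y] (e : X ≃ Y)
    (p : stdSimplex ℝ X) (y : Y) : relabelDist e p y = p (e.symm y) := rfl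

/-- Element-wise application of an isomorphism to an action-observation history. -/
def Iso.mapHist {D E : DecPOMDP} (f : Iso D E) (i : Fin D.N) (τ : D.AOHist i) :
    E.AOHist (f.fN i) :=
  ⟨Fin.cast (by rw [f.horizon]) τ.1, fun k => (f.fA i (τ.2 k).1, f.fO i (τ.2 k).2)⟩

@[simp] theorem Iso.invHist_mapHist {D E : DecPOMDP} (f : Iso D E) (i : Fin D.N)
    (τ : D.AOHist i) : f.invHist i (f.mapHist i τ) = τ :=
  Sigma.ext rfl (heq_of_eq (by funext k; simp [invHist, mapHist]))

@[simp] theorem Iso.mapHist_invHist {D E : DecPOMDP} (f : Iso D E) (i : Fin D.N)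
    (τ : E.AOHist (f.fN i)) : f.mapHist i (f.invHist i τ) = τ :=
  Sigma.ext rfl (heq_of_eq (by funext k; simp [invHist, mapHist]))

/-- The pushforward of local policies of agent `i`. -/
def Iso.pushLocal {D E : DecPOMDP} (f : Iso D E) (i : Fin D.N) :
    D.LocalPolicy i ≃ᵐ E.LocalPolicy (f.fN i) where
  toFun p τ := relabelDist (f.fA i) (p (f.invHist i τ))
  invFun q τ := relabelDist (f.fA i).symm (q (f.mapHist i τ))
  left_inv p := by funext τ; ext a; simp
  right_inv q := by funext τ; ext a; simp
  measurable_toFun := measurable_pi_lambda _ fun _ =>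
    (measurable_relabelDist _).comp (measurable_pi_apply _)
  measurable_invFun := measurable_pi_lambda _ fun _ =>
    (measurable_relabelDist _).comp (measurable_pi_apply _)

theorem Iso.pushLocal_apply {D E : DecPOMDP} (f : Iso D E) (i : Fin D.N) (p : D.LocalPolicy i)
    (τ : E.AOHist (f.fN i)) (a : E.Act (f.fN i)) :
    f.pushLocal i p τ a = p (f.invHist i τ) ((f.fA i).symm a) := rfl

theorem Iso.push_fN {D E : DecPOMDP} (f : Iso D E) (π : D.Policy) (i : Fin D.N) :
    f.push π (f.fN i) = f.pushLocal i (π i) :=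
  Equiv.piCongrLeft_apply_apply E.LocalPolicy f.fN _ i

theorem Iso.push_surjective {D E : DecPOMDP} (f : Iso D E) : Function.Surjective f.push := by
  intro ρ
  refine ⟨fun i => (f.pushLocal i).symm (ρ (f.fN i)), ?_⟩
  funext j
  obtain ⟨i, rfl⟩ := f.fN.surjective j
  rw [f.push_fN]
  exact (f.pushLocal i).apply_symm_apply _

theorem Iso.measurable_push {D E : DecPOMDP} (f : Iso D E) : Measurable f.push := by
  refine measurable_pi_lambda _ fun j => ?_
  obtain ⟨i, rfl⟩ := f.fN.surjective j
  simp only [f.push_fN]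
  exact (f.pushLocal i).measurable.comp (measurable_pi_apply i)

theorem Iso.push_trans {D E F : DecPOMDP} (f : Iso D E) (h : Iso E F) (π : D.Policy) :
    (f.trans h).push π = h.push (f.push π) := by
  funext j
  obtain ⟨i, rfl⟩ := (f.trans h).fN.surjective j
  rw [Iso.push_fN]
  change _ = h.push (f.push π) (h.fN (f.fN i))
  rw [Iso.push_fN, Iso.push_fN]
  rfl

/-! ### Invariance of the expected return -/

/-- Element-wise application of an isomorphism to entire histories. -/
def Iso.history {D E : DecPOMDP} (f : Iso D E) : D.History ≃ E.History :=
  (Equiv.arrowCongr (finCongr (by rw [f.horizon])) f.fS).prodCongr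
    ((Equiv.arrowCongr (finCongr (by rw [f.horizon])) (Equiv.piCongr f.fN f.fA)).prodCongr
      (Equiv.arrowCongr (finCongr f.horizon) (Equiv.piCongr f.fN f.fO)))

theorem Iso.history_state {D E : DecPOMDP} (f : Iso D E) (h : D.History) (t : Fin (E.T + 1)) :
    (f.history h).state t = f.fS (h.state (Fin.cast (by rw [f.horizon]) t)) := rfl

theorem Iso.history_act {D E : DecPOMDP} (f : Iso D E) (h : D.History) (t : Fin (E.T + 1)) :
    (f.history h).act t = Equiv.piCongr f.fN f.fA (h.act (Fin.cast (by rw [f.horizon]) t)) := rfl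

theorem Iso.history_obs {D E : DecPOMDP} (f : Iso D E) (h : D.History) (t : Fin E.T) :
    (f.history h).obs t = Equiv.piCongr f.fN f.fO (h.obs (Fin.cast (by rw [f.horizon]) t)) := rfl

theorem Iso.history_aoHist {D E : DecPOMDP} (f : Iso D E) (h : D.History) (i : Fin D.N)
    (t : Fin (E.T + 1)) :
    (f.history h).aoHist (f.fN i) t = f.mapHist i (h.aoHist i (Fin.cast (by rw [f.horizon]) t)) := by
  refine Sigma.ext rfl (heq_of_eq ?_)
  funext k
  simp only [History.aoHist, f.history_act, f.history_obs, Equiv.piCongr_apply_apply, mapHist]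
  rfl

/-- The factors correspond one by one, after reindexing time along the equality of horizons and
agents along `f.fN`. -/
theorem Iso.histProb_push {D E : DecPOMDP} (f : Iso D E) (π : D.Policy) (h : D.History) :
    E.histProb (f.push π) (f.history h) = D.histProb π h := by
  unfold histProb
  congr 1
  · congr 1
    · rw [f.init_eq, f.history_state]; rfl
    · refine (Fintype.prod_equiv (finCongr f.horizon) _ _ fun t => ?_).symm
      rw [f.trans_eq, f.obs_eq, f.history_state, f.history_state, f.history_act, f.history_obs]
      rfl
  · refine (Fintype.prod_equiv (finCongr (by rw [f.horizon])) _ _ fun t => ?_).symm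
    refine Fintype.prod_equiv f.fN _ _ fun i => ?_
    rw [f.push_fN, f.history_aoHist, f.history_act, Equiv.piCongr_apply_apply, f.pushLocal_apply,
      f.invHist_mapHist, Equiv.symm_apply_apply]
    rfl

theorem Iso.J_push {D E : DecPOMDP} (f : Iso D E) (π : D.Policy) :
    E.J (f.push π) = D.J π := by
  unfold J
  refine (Fintype.sum_equiv f.history _ _ fun h => ?_).symm
  rw [f.histProb_push]
  congr 1
  refine Fintype.sum_equiv (finCongr (by rw [f.horizon])) _ _ fun t => ?_
  rw [f.reward_eq, f.history_state, f.history_act]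
  rfl

theorem Iso.prob_push {D E : DecPOMDP} (f : Iso D E) (π : D.Policy) (Q : Set E.History) :
    E.prob (f.push π) Q = D.prob π (f.history ⁻¹' Q) := by
  classical
  unfold prob
  refine (Fintype.sum_equiv f.history _ _ fun h => ?_).symm
  simp only [Set.indicator_apply, Set.mem_preimage, f.histProb_push]

/-! ### Invariance of other-play -/

/-- Conjugation of profiles of automorphisms by an isomorphism. -/
noncomputable def Iso.conjProfile {D E : DecPOMDP} (f : Iso D E) :
    (Fin D.N → D.Aut) ≃ (Fin E.N → E.Aut) :=
  Equiv.arrowCongr f.fN f.conj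

/-- Each agent's automorphism is conjugated separately, and the profile is moved along the agent
bijection, so the identity reduces to `Iso.trans_conj` for one agent. -/
theorem Iso.pushProfile_conjProfile {D E : DecPOMDP} (f : Iso D E) (g : Fin D.N → D.Aut)
    (π : D.Policy) :
    E.pushProfile (f.conjProfile g) (f.push π) = f.push (D.pushProfile g π) := by
  funext j
  obtain ⟨i, rfl⟩ := f.fN.surjective j
  rw [f.push_fN]
  simp only [pushProfile, conjProfile, Equiv.arrowCongr_apply, Function.comp_apply,
    Equiv.symm_apply_apply]
  rw [← Iso.push_trans, f.trans_conj, Iso.push_trans, f.push_fN]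

theorem Iso.JOP_push {D E : DecPOMDP} (f : Iso D E) (π : D.Policy) :
    E.JOP (f.push π) = D.JOP π := by
  unfold JOP
  refine (Fintype.expect_equiv f.conjProfile _ _ fun g => ?_).symm
  rw [f.pushProfile_conjProfile, f.J_push]

theorem Iso.opDist_push {D E : DecPOMDP} (f : Iso D E) (π : D.Policy) :
    E.opDist (f.push π) = (D.opDist π).map f.push := by
  unfold opDist
  have hN : E.N = D.N := Fin.equiv_iff_eq.1 ⟨f.fN.symm⟩
  rw [Measure.map_smul, Measure.map_finset_sum f.measurable_push.aemeasurable,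
    Fintype.card_congr f.conj]
  congr 1
  · rw [hN]
  · refine (Fintype.sum_equiv f.conjProfile _ _ fun g => ?_).symm
    rw [f.pushProfile_conjProfile, Measure.map_dirac' f.measurable_push]

theorem Iso.opDist_push_marginal {D E : DecPOMDP} (f : Iso D E) (π : D.Policy) (i : Fin D.N) :
    (E.opDist (f.push π)).map (fun ρ => ρ (f.fN i))
      = ((D.opDist π).map fun π' => π' i).map (f.pushLocal i) := by
  rw [f.opDist_push, Measure.map_map (measurable_pi_apply _) f.measurable_push,
    Measure.map_map (f.pushLocal i).measurable (measurable_pi_apply _)]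
  congr 1
  funext π'
  exact f.push_fN π' i

/-! ### Invariance of mixtures -/

/-- Pushforward of a family of distributions over local policies. -/
noncomputable def Iso.pushMixture {D E : DecPOMDP} (f : Iso D E)
    (ν : ∀ i, ProbabilityMeasure (D.LocalPolicy i)) :
    ∀ j, ProbabilityMeasure (E.LocalPolicy j) :=
  Equiv.piCongrLeft (fun j => ProbabilityMeasure (E.LocalPolicy j)) f.fN
    fun i => (ν i).map (f.pushLocal i).measurable.aemeasurable

theorem Iso.pushMixture_fN {D E : DecPOMDP} (f : Iso D E)
    (ν : ∀ i, ProbabilityMeasure (D.LocalPolicy i)) (i : Fin D.N) :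
    (f.pushMixture ν (f.fN i) : Measure (E.LocalPolicy (f.fN i)))
      = (ν i : Measure (D.LocalPolicy i)).map (f.pushLocal i) := by
  rw [pushMixture, Equiv.piCongrLeft_apply_apply]
  rfl

theorem Iso.pushMixture_surjective {D E : DecPOMDP} (f : Iso D E) :
    Function.Surjective f.pushMixture := by
  intro ν
  refine ⟨fun i => (ν (f.fN i)).map (f.pushLocal i).symm.measurable.aemeasurable, ?_⟩
  funext j
  obtain ⟨i, rfl⟩ := f.fN.surjective j
  apply Subtype.ext
  change (f.pushMixture _ (f.fN i) : Measure (E.LocalPolicy (f.fN i))) = _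
  rw [f.pushMixture_fN]
  change ((ν (f.fN i) : Measure (E.LocalPolicy (f.fN i))).map (f.pushLocal i).symm).map
    (f.pushLocal i) = _
  rw [Measure.map_map (f.pushLocal i).measurable (f.pushLocal i).symm.measurable]
  simp

theorem Iso.pi_pushMixture {D E : DecPOMDP} (f : Iso D E)
    (ν : ∀ i, ProbabilityMeasure (D.LocalPolicy i)) :
    Measure.pi (fun j => (f.pushMixture ν j : Measure (E.LocalPolicy j)))
      = (Measure.pi fun i => (ν i : Measure (D.LocalPolicy i))).map f.push := by
  rw [← Measure.pi_map_piCongrLeft f.fN]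
  simp only [f.pushMixture_fN]
  rw [← Measure.pi_map_pi (fun i => (f.pushLocal i).measurable.aemeasurable),
    Measure.map_map (MeasurableEquiv.measurable _) (by fun_prop)]
  rfl

/-! ### Measurability in the policy -/

theorem measurable_histProb (D : DecPOMDP) (h : D.History) :
    Measurable fun π : D.Policy => D.histProb π h := by
  unfold histProb
  refine Measurable.const_mul ?_ _
  refine Finset.measurable_prod _ fun t _ => Finset.measurable_prod _ fun i _ => ?_
  exact (measurable_coe_stdSimplex _).comp
    ((measurable_pi_apply (h.aoHist i t)).comp (measurable_pi_apply i))

theorem measurable_prob (D : DecPOMDP) (Q : Set D.History) :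
    Measurable fun π : D.Policy => D.prob π Q := by
  classical
  unfold prob
  refine Finset.measurable_sum _ fun h _ => ?_
  by_cases hQ : h ∈ Q
  · simpa [hQ] using D.measurable_histProb h
  · simp [hQ]

theorem measurable_J (D : DecPOMDP) : Measurable D.J := by
  unfold J
  exact Finset.measurable_sum _ fun h _ => (D.measurable_histProb h).mul_const _

theorem measurable_pushProfile (D : DecPOMDP) (g : Fin D.N → D.Aut) :
    Measurable (D.pushProfile g) :=
  measurable_pi_lambda _ fun i => (measurable_pi_apply i).comp (g i).measurable_push

theorem measurable_JOP (D : DecPOMDP) : Measurable D.JOP := by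
  unfold JOP
  simp only [Fintype.expect_eq_sum_div_card]
  exact (Finset.measurable_sum _ fun g _ =>
    D.measurable_J.comp (D.measurable_pushProfile g)).div_const _

/-! ### Conditional action probabilities under isomorphisms -/

theorem Iso.mixProb_pushMixture {D E : DecPOMDP} (f : Iso D E)
    (ν : ∀ i, ProbabilityMeasure (D.LocalPolicy i)) (Q : Set E.History) :
    E.mixProb (Measure.pi fun j => (f.pushMixture ν j : Measure (E.LocalPolicy j))) Q
      = D.mixProb (Measure.pi fun i => (ν i : Measure (D.LocalPolicy i))) (f.history ⁻¹' Q) := by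
  unfold mixProb
  rw [f.pi_pushMixture, integral_map f.measurable_push.aemeasurable
    (E.measurable_prob Q).aestronglyMeasurable]
  simp only [f.prob_push]

theorem Iso.history_preimage_reach {D E : DecPOMDP} (f : Iso D E) (i : Fin D.N)
    (τ : E.AOHist (f.fN i)) :
    f.history ⁻¹' E.reach (f.fN i) τ = D.reach i (f.invHist i τ) := by
  ext h
  simp only [Set.mem_preimage, reach, Set.mem_ofPred_eq, f.history_aoHist]
  constructor
  · intro hh
    rw [← f.invHist_mapHist i (h.aoHist i _)]
    exact congrArg _ hh
  · intro hh
    rw [← f.mapHist_invHist i τ]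
    exact congrArg _ hh

theorem Iso.history_preimage_plays {D E : DecPOMDP} (f : Iso D E) (i : Fin D.N)
    (τ : E.AOHist (f.fN i)) (a : E.Act (f.fN i)) :
    f.history ⁻¹' E.plays (f.fN i) τ a
      = D.plays i (f.invHist i τ) ((f.fA i).symm a) := by
  ext h
  simp only [Set.mem_preimage, plays, Set.mem_ofPred_eq, f.history_act,
    Equiv.piCongr_apply_apply, Equiv.eq_symm_apply]
  rfl

/-- The event of reaching a history is transported, and the prescribed marginal can be recovered
because pushing measures along a measurable equivalence is injective. -/
theorem Iso.witness_pushMixture_iff {D E : DecPOMDP} (f : Iso D E) (i : Fin D.N)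
    (μ : Measure (D.LocalPolicy i)) (τ : E.AOHist (f.fN i))
    (ν : ∀ j, ProbabilityMeasure (D.LocalPolicy j)) :
    E.Witness (f.fN i) (μ.map (f.pushLocal i)) τ (f.pushMixture ν)
      ↔ D.Witness i μ (f.invHist i τ) ν := by
  unfold Witness
  rw [f.mixProb_pushMixture, f.history_preimage_reach, f.pushMixture_fN,
    (f.pushLocal i).map_measurableEquiv_injective.eq_iff]

/-- The conditional probability that agent `i` plays `a` given its history `τ`, when the local
policies are drawn independently from `ν`. -/
noncomputable def condPlay (D : DecPOMDP) (i : Fin D.N)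
    (ν : ∀ j, ProbabilityMeasure (D.LocalPolicy j)) (τ : D.AOHist i) (a : D.Act i) : ℝ :=
  D.mixProb (Measure.pi fun j => (ν j : Measure (D.LocalPolicy j))) (D.plays i τ a ∩ D.reach i τ)
    / D.mixProb (Measure.pi fun j => (ν j : Measure (D.LocalPolicy j))) (D.reach i τ)

theorem Iso.condPlay_pushMixture {D E : DecPOMDP} (f : Iso D E) (i : Fin D.N)
    (ν : ∀ j, ProbabilityMeasure (D.LocalPolicy j)) (τ : E.AOHist (f.fN i))
    (a : E.Act (f.fN i)) :
    E.condPlay (f.fN i) (f.pushMixture ν) τ a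
      = D.condPlay i ν (f.invHist i τ) ((f.fA i).symm a) := by
  unfold condPlay
  rw [f.mixProb_pushMixture, f.mixProb_pushMixture, Set.preimage_inter,
    f.history_preimage_reach, f.history_preimage_plays]

/-- `mixturePolicy` uses a witness picked by choice, so its value is accessible only once all
witnesses are known to give the same conditional probability. -/
theorem mixturePolicy_eq_of_forall_witness {D : DecPOMDP} {i : Fin D.N}
    {μ : Measure (D.LocalPolicy i)} {τ : D.AOHist i} {a : D.Act i} {c : ℝ}
    (hex : ∃ ν, D.Witness i μ τ ν) (hc : ∀ ν, D.Witness i μ τ ν → D.condPlay i ν τ a = c) :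
    D.mixturePolicy i μ τ a = c := by
  unfold mixturePolicy
  rw [dif_pos hex]
  exact hc _ hex.choose_spec

/-- The symmetrizer of an isomorphic problem, where the conditional action probabilities of the
original problem are known not to depend on the choice of the other agents' distributions. -/
theorem Iso.symmetrizer_push {D E : DecPOMDP} (f : Iso D E) (π : D.Policy) (i : Fin D.N)
    (τ : D.AOHist i) (a : D.Act i)
    (hex : ∃ ν, D.Witness i ((D.opDist π).map fun π' => π' i) τ ν) {c : ℝ}
    (hc : ∀ ν, D.Witness i ((D.opDist π).map fun π' => π' i) τ ν → D.condPlay i ν τ a = c) :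
    E.symmetrizer (f.push π) (f.fN i) (f.mapHist i τ) (f.fA i a) = c := by
  unfold symmetrizer
  rw [f.opDist_push_marginal]
  refine mixturePolicy_eq_of_forall_witness ?_ ?_
  · obtain ⟨ν, hν⟩ := hex
    refine ⟨f.pushMixture ν, (f.witness_pushMixture_iff i _ _ ν).2 ?_⟩
    rwa [f.invHist_mapHist]
  · intro ν' hν'
    obtain ⟨ν, rfl⟩ := f.pushMixture_surjective ν'
    rw [f.witness_pushMixture_iff, f.invHist_mapHist] at hν'
    rw [f.condPlay_pushMixture, f.invHist_mapHist, Equiv.symm_apply_apply]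
    exact hc ν hν'

end DecPOMDP

namespace LeverGame
open DecPOMDP

/-! ### Automorphisms of the lever game -/

theorem pointDist_apply {X : Type} [Fintype X] [DecidableEq X] (x y : X) :
    pointDist x y = if y = x then 1 else 0 := by
  change (Pi.single x 1 : X → ℝ) y = _
  rw [Pi.single_apply]

theorem perm_rev (e : Equiv.Perm (Fin 2)) (i : Fin 2) : e i.rev = (e i).rev := by
  revert e i; decide

theorem sum_perm_two (F : Equiv.Perm (Fin 2) → ℝ) :
    ∑ e, F e = F 1 + F Fin.revPerm := by
  have h : (Finset.univ : Finset (Equiv.Perm (Fin 2))) = {1, Fin.revPerm} := by decide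
  rw [h, Finset.sum_pair (by decide)]

theorem eq_iff_of_perm {X : Type} (e : Equiv.Perm (Fin 2)) (u : Fin 2 → X) :
    u (e 0) = u (e 1) ↔ u 0 = u 1 := by
  have h : ∀ e : Equiv.Perm (Fin 2), (e 0 = 0 ∧ e 1 = 1) ∨ (e 0 = 1 ∧ e 1 = 0) := by decide
  obtain ⟨h0, h1⟩ | ⟨h0, h1⟩ := h e
  · rw [h0, h1]
  · rw [h0, h1, eq_comm]

/-- The automorphism that permutes the agents by `s` and the levers by `t`. -/
def leverAut (s t : Equiv.Perm (Fin 2)) : leverGame.Aut where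
  fN := s
  fS := Equiv.refl _
  fA _ := t
  fO _ := t
  horizon := rfl
  trans_eq _ _ _ := rfl
  obs_eq _ a o := by
    simp only [leverGame, pointDist_apply]
    congr 1
    have hi : ∀ i : Fin 2, (Equiv.piCongr s (fun _ => t) : (Fin 2 → Fin 2) ≃ (Fin 2 → Fin 2)) o (s i)
        = (Equiv.piCongr s (fun _ => t) : (Fin 2 → Fin 2) ≃ (Fin 2 → Fin 2)) a (s i).rev
          ↔ o i = a i.rev := fun i => by
      rw [← perm_rev, Equiv.piCongr_apply_apply, Equiv.piCongr_apply_apply, t.injective.eq_iff]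
    rw [eq_iff_iff, funext_iff, funext_iff]
    exact ⟨fun h j => by
      obtain ⟨i, rfl⟩ := s.surjective j
      exact (hi i).2 (h i), fun h i => (hi i).1 (h (s i))⟩
  reward_eq _ a := by
    simp only [leverGame]
    congr 1
    rw [eq_iff_iff, ← eq_iff_of_perm s (Equiv.piCongr s (fun _ => t) a)]
    rw [Equiv.piCongr_apply_apply, Equiv.piCongr_apply_apply, t.injective.eq_iff]
  init_eq _ := rfl

/-- The reward forces both agents' lever bijections to coincide, and the deterministic observation
kernel forces the observation bijections to equal that common one. -/
theorem leverAut_bijective :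
    Function.Bijective fun st : Equiv.Perm (Fin 2) × Equiv.Perm (Fin 2) =>
      leverAut st.1 st.2 := by
  constructor
  · rintro ⟨s, t⟩ ⟨s', t'⟩ h
    injection h with hN _ hA _
    have hN' : s = s' := hN
    subst hN'
    exact Prod.ext rfl (congrFun hA 0)
  · rintro ⟨s, u, A, O, _, _, hO, hR, _⟩
    have hA : ∀ i, A i = A 0 := by
      have h01 : A 1 = A 0 := by
        ext x : 1
        -- If both agents pull `x` the reward is `1`; images that differ would have reward `-1`.
        have h := hR 0 fun _ => x
        simp only [leverGame, if_true] at h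
        split_ifs at h with h'
        · rw [← eq_iff_of_perm s, Equiv.piCongr_apply_apply, Equiv.piCongr_apply_apply] at h'
          exact h'.symm
        · norm_num at h
      intro i
      fin_cases i
      · rfl
      · exact h01
    have hO' : ∀ i, O i = A 0 := by
      intro i
      ext x : 1
      -- When both pull `x`, both observe `x` with probability one, so the image observation must
      -- also be the certain one.
      have h := hO 0 (fun _ => x) (fun _ => x)
      simp only [leverGame, pointDist_apply, if_true] at h
      split_ifs at h with h'
      · have := congrFun h' (s i)
        rw [← perm_rev, Equiv.piCongr_apply_apply, Equiv.piCongr_apply_apply] at this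
        rw [← hA i.rev]
        exact this
      · norm_num at h
    -- Naming `A 0` as a free variable allows `A` itself to be substituted away.
    obtain ⟨t, ht⟩ : ∃ t, A 0 = t := ⟨_, rfl⟩
    obtain rfl : u = Equiv.refl _ := Subsingleton.elim _ _
    obtain rfl : A = fun _ => t := funext fun i => (hA i).trans ht
    obtain rfl : O = fun _ => t := funext hO'
    exact ⟨(s, t), rfl⟩

/-! ### Features of local policies -/

/-- Local policies, which are the same for both agents. -/
abbrev LeverLocal : Type := leverGame.LocalPolicy 0

/-- The history before the first round. -/
abbrev emptyHist (i : Fin 2) : leverGame.AOHist i := ⟨0, fun k => k.elim0⟩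

/-- The history before the second round of an agent who played `a` and observed `o`. -/
abbrev oneHist (i a o : Fin 2) : leverGame.AOHist i := ⟨1, fun _ => (a, o)⟩

theorem hist_cases (i : Fin 2) (τ : leverGame.AOHist i) :
    τ = emptyHist i ∨ ∃ a o, τ = oneHist i a o := by
  obtain ⟨t, u⟩ := τ
  change Fin 2 at t
  fin_cases t
  · left
    exact Sigma.ext rfl (heq_of_eq (funext fun k => k.elim0))
  · right
    refine ⟨(u 0).1, (u 0).2, Sigma.ext rfl (heq_of_eq (funext fun k => ?_))⟩
    change Fin 1 at k
    rw [Subsingleton.elim k 0]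

/-- The local policy with the two levers exchanged. -/
def flipLocal (p : LeverLocal) : LeverLocal := (leverAut 1 Fin.revPerm).pushLocal 0 p

/-- The probability of the first action `b`. -/
def firstProb (p : LeverLocal) (b : Fin 2) : ℝ := p (emptyHist 0) b

/-- The probability of the second action `b` after the own action `a` and the observation `o`. -/
def secondProb (p : LeverLocal) (a o b : Fin 2) : ℝ := p (oneHist 0 a o) b

theorem firstProb_flipLocal (p : LeverLocal) (b : Fin 2) :
    firstProb (flipLocal p) b = firstProb p b.rev := by
  have h : (leverAut 1 Fin.revPerm).invHist 0 (emptyHist 0) = emptyHist 0 :=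
    Sigma.ext rfl (heq_of_eq (funext fun k => k.elim0))
  exact congrFun (congrArg (fun τ => (p τ : Fin 2 → ℝ)) h) b.rev

theorem secondProb_flipLocal (p : LeverLocal) (a o b : Fin 2) :
    secondProb (flipLocal p) a o b = secondProb p a.rev o.rev b.rev := rfl

theorem firstProb_nonneg (p : LeverLocal) (b : Fin 2) : 0 ≤ firstProb p b :=
  stdSimplex.zero_le (p (emptyHist 0)) b

theorem secondProb_nonneg (p : LeverLocal) (a o b : Fin 2) : 0 ≤ secondProb p a o b :=
  stdSimplex.zero_le (p (oneHist 0 a o)) b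

theorem firstProb_one (p : LeverLocal) : firstProb p 1 = 1 - firstProb p 0 :=
  eq_sub_of_add_eq' (stdSimplex.add_eq_one (p (emptyHist 0)))

theorem secondProb_one (p : LeverLocal) (a o : Fin 2) :
    secondProb p a o 1 = 1 - secondProb p a o 0 :=
  eq_sub_of_add_eq' (stdSimplex.add_eq_one (p (oneHist 0 a o)))

theorem measurable_firstProb (b : Fin 2) : Measurable fun p => firstProb p b :=
  (measurable_coe_stdSimplex (X := Fin 2) b).comp (measurable_pi_apply (emptyHist 0))

theorem measurable_secondProb (a o b : Fin 2) : Measurable fun p => secondProb p a o b :=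
  (measurable_coe_stdSimplex (X := Fin 2) b).comp (measurable_pi_apply (oneHist 0 a o))

theorem rev_zero_two : Fin.rev (0 : Fin 2) = 1 := rfl

theorem rev_one_two : Fin.rev (1 : Fin 2) = 0 := rfl

theorem leverAut_push_one (s : Equiv.Perm (Fin 2)) (π : leverGame.Policy) (i : Fin 2) :
    (leverAut s 1).push π i = π (s.symm i) := by
  obtain ⟨j, rfl⟩ := s.surjective i
  refine ((leverAut s 1).push_fN π j).trans ?_
  rw [Equiv.symm_apply_apply]
  rfl

theorem leverAut_push_rev (s : Equiv.Perm (Fin 2)) (π : leverGame.Policy) (i : Fin 2) :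
    (leverAut s Fin.revPerm).push π i = flipLocal (π (s.symm i)) := by
  obtain ⟨j, rfl⟩ := s.surjective i
  refine ((leverAut s Fin.revPerm).push_fN π j).trans ?_
  rw [Equiv.symm_apply_apply]
  rfl

/-- Average over the automorphisms of a function of the local policy of agent `i`. -/
theorem expect_aut (π : leverGame.Policy) (i : Fin 2) (G : LeverLocal → ℝ) :
    𝔼 g : leverGame.Aut, G (g.push π i)
      = (G (π 0) + G (π 1) + G (flipLocal (π 0)) + G (flipLocal (π 1))) / 4 := by
  rw [← Fintype.expect_bijective _ leverAut_bijective
    (fun st => G ((leverAut st.1 st.2).push π i)) _ fun _ => rfl,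
    Fintype.expect_eq_sum_div_card, Fintype.sum_prod_type_right, sum_perm_two]
  simp only [leverAut_push_one, leverAut_push_rev, sum_perm_two]
  have hc : Fintype.card (Equiv.Perm (Fin 2) × Equiv.Perm (Fin 2)) = 4 := by decide
  rw [hc]
  fin_cases i
  · change (G (π 0) + G (π 1) + (G (flipLocal (π 0)) + G (flipLocal (π 1)))) / ((4 : ℕ) : ℝ) = _
    push_cast; ring
  · change (G (π 1) + G (π 0) + (G (flipLocal (π 1)) + G (flipLocal (π 0)))) / ((4 : ℕ) : ℝ) = _
    push_cast; ring

/-- The quantities of a local policy on which the expected return depends: the bias of the first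
action, and, for a first action `a` and an observation `o`, the probability of `a` times the bias
of the second action. -/
def feature (p : LeverLocal) : Option (Fin 2 × Fin 2) → ℝ
  | none => firstProb p 0 - firstProb p 1
  | some (a, o) => firstProb p a * (secondProb p a o 0 - secondProb p a o 1)

/-- The feature of the other agent that a feature is paired with. -/
def swapIdx (c : Option (Fin 2 × Fin 2)) : Option (Fin 2 × Fin 2) := c.map Prod.swap

theorem measurable_feature (c : Option (Fin 2 × Fin 2)) :
    Measurable fun p : LeverLocal => feature p c := by
  rcases c with _ | ⟨a, o⟩
  · exact (measurable_firstProb _).sub (measurable_firstProb _)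
  · exact (measurable_firstProb _).mul ((measurable_secondProb _ _ _).sub
      (measurable_secondProb _ _ _))

theorem abs_secondProb_sub_le (p : LeverLocal) (a o : Fin 2) :
    |secondProb p a o 0 - secondProb p a o 1| ≤ 1 := by
  have h0 := secondProb_nonneg p a o 0
  have h1 := secondProb_nonneg p a o 1
  have h2 := secondProb_one p a o
  exact abs_le.2 ⟨by linarith, by linarith⟩

theorem abs_feature_some_le (p : LeverLocal) (a o : Fin 2) :
    |feature p (some (a, o))| ≤ firstProb p a := by
  rw [feature, abs_mul, abs_of_nonneg (firstProb_nonneg _ _)]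
  exact mul_le_of_le_one_right (firstProb_nonneg _ _) (abs_secondProb_sub_le p a o)

theorem abs_feature_le (p : LeverLocal) (c : Option (Fin 2 × Fin 2)) : |feature p c| ≤ 1 := by
  have h0 := firstProb_nonneg p 0
  have h1 := firstProb_nonneg p 1
  have h2 := firstProb_one p
  rcases c with _ | ⟨a, o⟩
  · exact abs_le.2 ⟨by rw [feature]; linarith, by rw [feature]; linarith⟩
  · refine (abs_feature_some_le p a o).trans ?_
    fin_cases a
    · change firstProb p 0 ≤ 1; linarith
    · change firstProb p 1 ≤ 1; linarith

/-- The average of a feature over agents and lever permutations. -/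
noncomputable def symFeature (π : leverGame.Policy) (c : Option (Fin 2 × Fin 2)) : ℝ :=
  (feature (π 0) c + feature (π 1) c + feature (flipLocal (π 0)) c
    + feature (flipLocal (π 1)) c) / 4

theorem expect_feature (π : leverGame.Policy) (i : Fin 2) (c : Option (Fin 2 × Fin 2)) :
    𝔼 g : leverGame.Aut, feature (g.push π i) c = symFeature π c :=
  expect_aut π i fun p => feature p c

/-- Exchanging the levers negates the first-round bias, so the four terms cancel in pairs. -/
theorem symFeature_none (π : leverGame.Policy) : symFeature π none = 0 := by
  simp only [symFeature, feature, firstProb_flipLocal, rev_zero_two, rev_one_two]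
  ring

theorem symFeature_rev (π : leverGame.Policy) (a o : Fin 2) :
    symFeature π (some (a.rev, o.rev)) = -symFeature π (some (a, o)) := by
  simp only [symFeature, feature, firstProb_flipLocal, secondProb_flipLocal, Fin.rev_rev,
    rev_zero_two, rev_one_two]
  ring

/-- The symmetrized bias towards repeating after successful coordination. -/
noncomputable def repeatBias (π : leverGame.Policy) : ℝ := symFeature π (some (0, 0))

/-- The symmetrized bias towards repeating after failed coordination. -/
noncomputable def failBias (π : leverGame.Policy) : ℝ := symFeature π (some (0, 1))

theorem symFeature_one_one (π : leverGame.Policy) :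
    symFeature π (some (1, 1)) = -repeatBias π := symFeature_rev π 0 0

theorem symFeature_one_zero (π : leverGame.Policy) :
    symFeature π (some (1, 0)) = -failBias π := symFeature_rev π 0 1

/-- All five symmetrized features are linear in the two biases. The factor `t = 1` serves policies
of one class, and `t = -1` compares `policyS` with `policyR`. -/
theorem symFeature_eq_of_bias {π π' : leverGame.Policy} {t : ℝ}
    (hr : repeatBias π = t * repeatBias π') (hf : failBias π = t * failBias π')
    (c : Option (Fin 2 × Fin 2)) : symFeature π c = t * symFeature π' c := by
  have h : ∀ a o, symFeature π (some (a, o)) = t * symFeature π' (some (a, o)) := by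
    intro a o
    fin_cases a <;> fin_cases o
    · exact hr
    · exact hf
    · refine (symFeature_one_zero π).trans (Eq.trans ?_
        (congrArg (t * ·) (symFeature_one_zero π').symm))
      simp only [hf, mul_neg]
    · refine (symFeature_one_one π).trans (Eq.trans ?_
        (congrArg (t * ·) (symFeature_one_one π').symm))
      simp only [hr, mul_neg]
  rcases c with _ | ⟨a, o⟩
  · rw [symFeature_none, symFeature_none, mul_zero]
  · exact h a o

theorem sum_option_two (F : Option (Fin 2 × Fin 2) → ℝ) :
    ∑ c, F c = F none + (F (some (0, 0)) + F (some (0, 1))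
      + (F (some (1, 0)) + F (some (1, 1)))) := by
  rw [Fintype.sum_option, Fintype.sum_prod_type, Fin.sum_univ_two, Fin.sum_univ_two,
    Fin.sum_univ_two]

/-- For one agent, the feature at `(0, 0)` is at most the probability of first playing `0`, and
after the lever flip at most that of first playing `1`. These sum to one, so two agents contribute
at most `2` before the division by `4`. -/
theorem abs_repeatBias_le (π : leverGame.Policy) : |repeatBias π| ≤ 1 / 2 := by
  have key : ∀ p : LeverLocal,
      |feature p (some (0, 0)) + feature (flipLocal p) (some (0, 0))| ≤ 1 := by
    intro p
    refine (abs_add_le _ _).trans ?_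
    have h0 := abs_feature_some_le p 0 0
    have h1 := abs_feature_some_le (flipLocal p) 0 0
    rw [firstProb_flipLocal, rev_zero_two, firstProb_one] at h1
    linarith
  have h0 := abs_le.1 (key (π 0))
  have h1 := abs_le.1 (key (π 1))
  rw [repeatBias, symFeature]
  exact abs_le.2 ⟨by linarith [h0.1, h1.1], by linarith [h0.2, h1.2]⟩

/-! ### The expected return -/

/-- The history in which the joint actions are `a` and `b`. -/
def leverHist (a b : Fin 2 → Fin 2) : leverGame.History :=
  (fun _ => 0, ![a, b], fun _ i => a i.rev)

theorem leverHist_aoHist_zero (a b : Fin 2 → Fin 2) (i : Fin 2) :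
    (leverHist a b).aoHist i 0 = emptyHist i :=
  Sigma.ext rfl (heq_of_eq (funext fun k => k.elim0))

theorem leverHist_aoHist_one (a b : Fin 2 → Fin 2) (i : Fin 2) :
    (leverHist a b).aoHist i 1 = oneHist i (a i) (a i.rev) := by
  refine Sigma.ext rfl (heq_of_eq (funext fun k => ?_))
  change Fin 1 at k
  rw [Subsingleton.elim k 0]
  rfl

theorem histProb_leverHist (π : leverGame.Policy) (a b : Fin 2 → Fin 2) :
    leverGame.histProb π (leverHist a b)
      = (firstProb (π 0) (a 0) * firstProb (π 1) (a 1))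
        * (secondProb (π 0) (a 0) (a 1) (b 0) * secondProb (π 1) (a 1) (a 0) (b 1)) := by
  have h1 : ∀ t : Fin 1, (pointDist (0 : Fin 1) ((leverHist a b).state t.succ)
      * pointDist (fun i : Fin 2 => (leverHist a b).act t.castSucc i.rev)
        ((leverHist a b).obs t)) = 1 := by
    intro t
    have ho : (leverHist a b).obs t = fun i : Fin 2 => (leverHist a b).act t.castSucc i.rev := by
      rw [Subsingleton.elim t 0]; rfl
    rw [pointDist_apply, pointDist_apply, if_pos (Subsingleton.elim _ _), if_pos ho, mul_one]
  unfold histProb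
  rw [Finset.prod_congr rfl fun t _ => h1 t]
  change pointDist (0 : Fin 1) _ * _ * ∏ t : Fin 2, ∏ i : Fin 2, _ = _
  rw [pointDist_apply, if_pos (Subsingleton.elim _ _), Fin.prod_univ_two, Fin.prod_univ_two,
    Fin.prod_univ_two, Finset.prod_const_one, leverHist_aoHist_zero, leverHist_aoHist_zero,
    leverHist_aoHist_one, leverHist_aoHist_one]
  rw [one_mul, one_mul]
  rfl

/-- Observations are a function of the first joint action, so any other history has a vanishing
observation factor. Sums over histories thus reduce to sums over two joint actions. -/
theorem histProb_eq_zero (π : leverGame.Policy) (h : leverGame.History)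
    (hh : h ∉ Set.range fun ab : (Fin 2 → Fin 2) × (Fin 2 → Fin 2) => leverHist ab.1 ab.2) :
    leverGame.histProb π h = 0 := by
  have h1 : pointDist (fun i : Fin 2 => h.act 0 i.rev) (h.obs 0) = 0 := by
    rw [pointDist_apply, if_neg]
    intro ho
    refine hh ⟨(h.act 0, h.act 1), ?_⟩
    refine Prod.ext (Subsingleton.elim _ _) (Prod.ext ?_ ?_)
    · funext t
      change Fin 2 at t
      fin_cases t <;> rfl
    · funext t
      change Fin 1 at t
      rw [Subsingleton.elim t 0]
      exact ho.symm
  unfold histProb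
  have h2 : ∏ t : Fin leverGame.T, leverGame.trans (h.state t.castSucc) (h.act t.castSucc)
      (h.state t.succ) * leverGame.obsKer (h.state t.succ) (h.act t.castSucc) (h.obs t) = 0 :=
    Finset.prod_eq_zero (Finset.mem_univ 0) (mul_eq_zero_of_right _ h1)
  rw [h2, mul_zero, zero_mul]

theorem leverHist_injective : Function.Injective
    fun ab : (Fin 2 → Fin 2) × (Fin 2 → Fin 2) => leverHist ab.1 ab.2 := by
  rintro ⟨a, b⟩ ⟨a', b'⟩ h
  have h1 := congrArg (fun h : leverGame.History => h.2.1) h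
  exact Prod.ext (congrFun h1 0) (congrFun h1 1)

theorem sum_fun_two (F : (Fin 2 → Fin 2) → ℝ) :
    ∑ a, F a = F ![0, 0] + F ![0, 1] + (F ![1, 0] + F ![1, 1]) := by
  rw [← (finTwoArrowEquiv (Fin 2)).symm.sum_comp, Fintype.sum_prod_type, Fin.sum_univ_two,
    Fin.sum_univ_two, Fin.sum_univ_two]
  rfl

theorem sum_histProb_mul (π : leverGame.Policy) (F : leverGame.History → ℝ) :
    ∑ h, leverGame.histProb π h * F h
      = ∑ a : Fin 2 → Fin 2, ∑ b : Fin 2 → Fin 2,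
        leverGame.histProb π (leverHist a b) * F (leverHist a b) := by
  rw [← Fintype.sum_prod_type' (f := fun a b : Fin 2 → Fin 2 =>
    leverGame.histProb π (leverHist a b) * F (leverHist a b))]
  refine (Fintype.sum_of_injective _ leverHist_injective _ _ ?_ fun _ => rfl).symm
  intro h hh
  rw [histProb_eq_zero π h hh, zero_mul]

/-- In each round the expected reward is a product of biases. In the second round this holds
conditionally on the first actions, whose probability splits between the agents; the own action of
one is the observation of the other, hence `swapIdx`. -/
theorem J_eq (π : leverGame.Policy) :
    leverGame.J π = ∑ c, feature (π 0) c * feature (π 1) (swapIdx c) := by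
  have hr : ∀ a b : Fin 2 → Fin 2,
      ∑ t, leverGame.reward ((leverHist a b).state t) ((leverHist a b).act t)
        = (if a 0 = a 1 then 1 else -1) + if b 0 = b 1 then 1 else -1 := fun a b => by
    change ∑ t : Fin 2, _ = _
    rw [Fin.sum_univ_two]
    rfl
  unfold J
  rw [sum_histProb_mul]
  simp only [hr, histProb_leverHist, sum_fun_two, sum_option_two, swapIdx, feature, Option.map,
    Prod.swap, Matrix.cons_val_zero, Matrix.cons_val_one, zero_ne_one, one_ne_zero, if_true,
    if_false, firstProb_one, secondProb_one]
  ring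

/-! ### The other-play value -/

/-- Independence of the two coordinates. The dependent form is needed for isomorphisms out of two
different relabeled problems. -/
theorem expect_pi_two {A : Fin 2 → Type*} [∀ k, Fintype (A k)] (F : ∀ k, A k → ℝ) :
    𝔼 g : ∀ k, A k, F 0 (g 0) * F 1 (g 1) = (𝔼 x, F 0 x) * 𝔼 y, F 1 y := by
  refine (Fintype.expect_equiv (piFinTwoEquiv A) _ (fun xy => F 0 xy.1 * F 1 xy.2)
    fun _ => rfl).trans ?_
  rw [← Finset.univ_product_univ, Finset.expect_product' _ _ fun x y => F 0 x * F 1 y,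
    Fintype.expect_mul_expect]

theorem expect_pi_two_apply {A : Type*} [Fintype A] [Nonempty A] (i : Fin 2) (F : A → ℝ) :
    𝔼 g : Fin 2 → A, F (g i) = 𝔼 x, F x := by
  fin_cases i
  · simpa using expect_pi_two (A := fun _ => A) ![F, 1]
  · simpa using expect_pi_two (A := fun _ => A) ![1, F]

instance : Nonempty leverGame.Aut := ⟨leverAut 1 1⟩

theorem sum_symFeature_mul (π π' : leverGame.Policy) :
    ∑ c, symFeature π c * symFeature π' (swapIdx c)
      = 2 * (repeatBias π * repeatBias π') - 2 * (failBias π * failBias π') := by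
  simp only [sum_option_two, swapIdx, Option.map, Prod.swap, symFeature_none, symFeature_one_one,
    symFeature_one_zero]
  rw [← repeatBias, ← failBias, ← repeatBias, ← failBias]
  ring

/-- The agents' automorphisms are independent, so the average of the bilinear form `J_eq` is the
same form at the symmetrized features. The minus sign arises because `(0, 1)` is paired with `(1,
0)`, whose symmetrized feature is the opposite. -/
theorem JOP_eq (π : leverGame.Policy) :
    leverGame.JOP π = 2 * repeatBias π ^ 2 - 2 * failBias π ^ 2 := by
  unfold JOP
  simp only [J_eq, pushProfile]
  rw [Finset.expect_sum_comm]
  have h : ∀ c, (𝔼 g : Fin 2 → leverGame.Aut,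
      feature ((g 0).push π 0) c * feature ((g 1).push π 1) (swapIdx c))
        = symFeature π c * symFeature π (swapIdx c) := fun c => by
    have := expect_pi_two (A := fun _ => leverGame.Aut)
      (fun k g => feature (g.push π k) (if k = 0 then c else swapIdx c))
    simp only [if_true, one_ne_zero, if_false] at this
    rw [expect_feature, expect_feature] at this
    exact this
  refine (Finset.sum_congr rfl fun c _ => h c).trans ?_
  rw [sum_symFeature_mul]
  ring

theorem JOP_le (π : leverGame.Policy) : leverGame.JOP π ≤ 1 / 2 := by
  rw [JOP_eq]
  have h : repeatBias π ^ 2 ≤ (1 / 2) ^ 2 := sq_le_sq' (abs_le.1 (abs_repeatBias_le π)).1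
    (abs_le.1 (abs_repeatBias_le π)).2
  nlinarith [sq_nonneg (failBias π)]

theorem JOP_eq_half_iff (π : leverGame.Policy) :
    leverGame.JOP π = 1 / 2 ↔
      (repeatBias π = 1 / 2 ∧ failBias π = 0) ∨ (repeatBias π = -1 / 2 ∧ failBias π = 0) := by
  rw [JOP_eq]
  constructor
  · intro h
    have h1 : repeatBias π ^ 2 ≤ (1 / 2) ^ 2 := sq_le_sq' (abs_le.1 (abs_repeatBias_le π)).1
      (abs_le.1 (abs_repeatBias_le π)).2
    have h2 := sq_nonneg (failBias π)
    -- The `repeatBias` term contributes at most `1/2`, so nothing may be subtracted.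
    have h3 : failBias π = 0 := pow_eq_zero_iff two_ne_zero |>.1 (by linarith)
    have h4 : (repeatBias π - 1 / 2) * (repeatBias π + 1 / 2) = 0 := by
      rw [h3] at h; linarith
    rcases mul_eq_zero.1 h4 with h | h
    · exact Or.inl ⟨by linarith, h3⟩
    · exact Or.inr ⟨by linarith, h3⟩
  · rintro (⟨h1, h2⟩ | ⟨h1, h2⟩) <;> rw [h1, h2] <;> norm_num

/-! ### The symmetrizer -/

theorem integral_dirac_measurable {X : Type*} [MeasurableSpace X] {G : X → ℝ} (hG : Measurable G)
    (x : X) : ∫ y, G y ∂(Measure.dirac x) = G x :=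
  integral_dirac' G x hG.stronglyMeasurable

instance (π : leverGame.Policy) : IsProbabilityMeasure (leverGame.opDist π) := by
  constructor
  have hc : (Fintype.card leverGame.Aut : ENNReal) ^ leverGame.N ≠ 0 :=
    pow_ne_zero _ (Nat.cast_ne_zero.2 Fintype.card_ne_zero)
  have hc' : (Fintype.card leverGame.Aut : ENNReal) ^ leverGame.N ≠ ⊤ :=
    ENNReal.pow_ne_top (ENNReal.natCast_ne_top _)
  simp only [opDist, Measure.smul_apply, Measure.finsetSum_apply, measure_univ, Finset.sum_const,
    Finset.card_univ, Fintype.card_fun, Fintype.card_fin, nsmul_eq_mul, mul_one, smul_eq_mul]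
  rw [Nat.cast_pow]
  exact ENNReal.inv_mul_cancel hc hc'

/-- The distribution of the local policy of agent `i` under the other-play distribution. -/
noncomputable def opMarginal (π : leverGame.Policy) (i : Fin 2) :
    ProbabilityMeasure (leverGame.LocalPolicy i) :=
  ⟨(leverGame.opDist π).map fun π' => π' i,
    Measure.isProbabilityMeasure_map (measurable_pi_apply i).aemeasurable⟩

theorem integral_opMarginal (π : leverGame.Policy) (i : Fin 2) {G : LeverLocal → ℝ}
    (hG : Measurable G) :
    ∫ p, G p ∂(opMarginal π i : Measure (leverGame.LocalPolicy i))
      = (G (π 0) + G (π 1) + G (flipLocal (π 0)) + G (flipLocal (π 1))) / 4 := by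
  have hGi : Measurable fun π' : leverGame.Policy => G (π' i) := hG.comp (measurable_pi_apply i)
  change ∫ p : LeverLocal, G p ∂((leverGame.opDist π).map fun π' => π' i) = _
  rw [integral_map (measurable_pi_apply i).aemeasurable hG.aestronglyMeasurable, opDist,
    integral_smul_measure, integral_finsetSum_measure fun g _ =>
      integrable_dirac' hGi.stronglyMeasurable enorm_lt_top]
  simp only [integral_dirac_measurable hGi]
  rw [← expect_aut π i G, ← expect_pi_two_apply i, Fintype.expect_eq_sum_div_card, smul_eq_mul,
    ENNReal.toReal_inv, ENNReal.toReal_pow, ENNReal.toReal_natCast, Fintype.card_fun,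
    Nat.cast_pow, Fintype.card_fin, div_eq_inv_mul]
  rfl

/-! ### Probabilities of local histories and actions in the lever game -/

theorem prob_eq (π : leverGame.Policy) (Q : Set leverGame.History) :
    leverGame.prob π Q = ∑ a : Fin 2 → Fin 2, ∑ b : Fin 2 → Fin 2,
      leverGame.histProb π (leverHist a b) * Q.indicator 1 (leverHist a b) := by
  rw [← sum_histProb_mul, prob]
  refine Finset.sum_congr rfl fun h _ => ?_
  by_cases hQ : h ∈ Q <;> simp [hQ]

theorem leverHist_mem_reach_one (u v : Fin 2 → Fin 2) (i a o : Fin 2) :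
    leverHist u v ∈ leverGame.reach i (oneHist i a o) ↔ u i = a ∧ u i.rev = o := by
  change (leverHist u v).aoHist i 1 = _ ↔ _
  rw [leverHist_aoHist_one]
  constructor
  · intro h
    have h1 := congrFun (eq_of_heq (Sigma.mk.inj h).2) ⟨0, Nat.one_pos⟩
    exact ⟨congrArg Prod.fst h1, congrArg Prod.snd h1⟩
  · rintro ⟨rfl, rfl⟩; rfl

theorem leverHist_mem_plays_one (u v : Fin 2 → Fin 2) (i a o b : Fin 2) :
    leverHist u v ∈ leverGame.plays i (oneHist i a o) b ↔ v i = b := Iff.rfl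

theorem leverHist_mem_plays_empty (u v : Fin 2 → Fin 2) (i b : Fin 2) :
    leverHist u v ∈ leverGame.plays i (emptyHist i) b ↔ u i = b := Iff.rfl

theorem reach_empty (i : Fin 2) : leverGame.reach i (emptyHist i) = Set.univ := by
  ext h
  simp only [Set.mem_univ, iff_true]
  exact Sigma.ext rfl (heq_of_eq (funext fun k => k.elim0))

theorem prob_reach_one (π : leverGame.Policy) (i a o : Fin 2) :
    leverGame.prob π (leverGame.reach i (oneHist i a o))
      = firstProb (π i) a * firstProb (π i.rev) o := by
  classical
  rw [prob_eq]
  simp only [Set.indicator_apply, leverHist_mem_reach_one, histProb_leverHist, sum_fun_two,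
    Matrix.cons_val_zero, Matrix.cons_val_one, Pi.one_apply]
  fin_cases i <;> fin_cases a <;> fin_cases o <;>
    simp [rev_zero_two, rev_one_two, secondProb_one] <;> ring

theorem prob_plays_inter_reach_one (π : leverGame.Policy) (i a o b : Fin 2) :
    leverGame.prob π (leverGame.plays i (oneHist i a o) b ∩ leverGame.reach i (oneHist i a o))
      = firstProb (π i) a * secondProb (π i) a o b * firstProb (π i.rev) o := by
  classical
  rw [prob_eq]
  simp only [Set.indicator_apply, Set.mem_inter_iff, leverHist_mem_plays_one,
    leverHist_mem_reach_one, histProb_leverHist, sum_fun_two,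
    Matrix.cons_val_zero, Matrix.cons_val_one, Pi.one_apply]
  fin_cases i <;> fin_cases a <;> fin_cases o <;> fin_cases b <;>
    simp [rev_zero_two, rev_one_two, secondProb_one] <;> ring

theorem prob_reach_empty (π : leverGame.Policy) (i : Fin 2) :
    leverGame.prob π (leverGame.reach i (emptyHist i)) = 1 := by
  rw [prob_eq, reach_empty]
  simp only [Set.indicator_univ, histProb_leverHist, sum_fun_two,
    Matrix.cons_val_zero, Matrix.cons_val_one, Pi.one_apply, firstProb_one, secondProb_one]
  ring

theorem prob_plays_inter_reach_empty (π : leverGame.Policy) (i b : Fin 2) :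
    leverGame.prob π (leverGame.plays i (emptyHist i) b ∩ leverGame.reach i (emptyHist i))
      = firstProb (π i) b := by
  classical
  rw [prob_eq, reach_empty, Set.inter_univ]
  simp only [Set.indicator_apply, leverHist_mem_plays_empty, histProb_leverHist, sum_fun_two,
    Matrix.cons_val_zero, Matrix.cons_val_one, Pi.one_apply]
  fin_cases i <;> fin_cases b <;>
    simp [firstProb_one, secondProb_one] <;> ring

theorem integral_pi_two (ν : ∀ j : Fin 2, ProbabilityMeasure (leverGame.LocalPolicy j))
    (i : Fin 2) (G H : LeverLocal → ℝ) :
    ∫ π : leverGame.Policy, G (π i) * H (π i.rev)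
        ∂(Measure.pi fun j => (ν j : Measure (leverGame.LocalPolicy j)))
      = (∫ p, G p ∂(ν i : Measure (leverGame.LocalPolicy i)))
        * ∫ p, H p ∂(ν i.rev : Measure (leverGame.LocalPolicy i.rev)) := by
  fin_cases i
  · have h := integral_fintype_prod_eq_prod (𝕜 := ℝ) (E := leverGame.LocalPolicy)
      (fun j : Fin 2 => if j = 0 then G else H)
      (μ := fun j => (ν j : Measure (leverGame.LocalPolicy j)))
    change (∫ π : leverGame.Policy, ∏ j : Fin 2, _ ∂_) = ∏ j : Fin 2, _ at h
    simp only [Fin.prod_univ_two] at h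
    exact h
  · have h := integral_fintype_prod_eq_prod (𝕜 := ℝ) (E := leverGame.LocalPolicy)
      (fun j : Fin 2 => if j = 0 then H else G)
      (μ := fun j => (ν j : Measure (leverGame.LocalPolicy j)))
    change (∫ π : leverGame.Policy, ∏ j : Fin 2, _ ∂_) = ∏ j : Fin 2, _ at h
    simp only [Fin.prod_univ_two] at h
    rw [mul_comm]
    refine Eq.trans ?_ h
    refine integral_congr_ae (Filter.Eventually.of_forall fun π => ?_)
    exact mul_comm _ _

/-! ### Action probabilities of the symmetrized policy -/

/-- The lever flip makes the first action uniform for every `π`; in particular no history is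
excluded by the agent's own play. -/
theorem integral_firstProb_opMarginal (π : leverGame.Policy) (i a : Fin 2) :
    ∫ p, firstProb p a ∂(opMarginal π i : Measure (leverGame.LocalPolicy i)) = 1 / 2 := by
  rw [integral_opMarginal π i (measurable_firstProb a)]
  simp only [firstProb_flipLocal]
  fin_cases a
  · change (firstProb (π 0) 0 + firstProb (π 1) 0 + firstProb (π 0) 1 + firstProb (π 1) 1) / 4 = _
    simp only [firstProb_one]; ring
  · change (firstProb (π 0) 1 + firstProb (π 1) 1 + firstProb (π 0) 0 + firstProb (π 1) 0) / 4 = _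
    simp only [firstProb_one]; ring

/-- The action probabilities of the symmetrized policy in the second round. -/
noncomputable def symSecond (π : leverGame.Policy) (a o b : Fin 2) : ℝ :=
  if b = 0 then 1 / 2 + symFeature π (some (a, o)) else 1 / 2 - symFeature π (some (a, o))

theorem integral_first_mul_second_opMarginal (π : leverGame.Policy) (i a o b : Fin 2) :
    ∫ p, firstProb p a * secondProb p a o b ∂(opMarginal π i : Measure (leverGame.LocalPolicy i))
      = symSecond π a o b / 2 := by
  have hf := integral_firstProb_opMarginal π i a
  rw [integral_opMarginal π i (measurable_firstProb a)] at hf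
  refine (integral_opMarginal π i
    ((measurable_firstProb a).mul (measurable_secondProb a o b))).trans ?_
  simp only [symSecond, symFeature, feature, Pi.mul_apply]
  -- Writing `p` for the first-action probability, `p` times the probability of the second action is
  -- `p / 2` plus or minus half the feature; `hf` averages `p` to `1/2`.
  fin_cases b
  · simp only [Fin.zero_eta, if_true, secondProb_one]
    linear_combination hf / 2
  · simp only [Fin.mk_one, one_ne_zero, if_false, secondProb_one]
    linear_combination hf / 2

/-- The action probabilities of the symmetrized policy do not depend on the distributions of the
other agent's policy. -/
theorem condPlay_one (π : leverGame.Policy) (i a o b : Fin 2)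
    (ν : ∀ j, ProbabilityMeasure (leverGame.LocalPolicy j))
    (hν : leverGame.Witness i ((leverGame.opDist π).map fun π' => π' i) (oneHist i a o) ν) :
    leverGame.condPlay i ν (oneHist i a o) b = symSecond π a o b := by
  obtain ⟨hμ, hpos⟩ := hν
  have hi : ν i = opMarginal π i := Subtype.ext hμ
  unfold mixProb at hpos
  unfold condPlay mixProb
  simp only [prob_reach_one, prob_plays_inter_reach_one] at hpos ⊢
  rw [integral_pi_two ν i (fun p => firstProb p a) (fun p => firstProb p o), hi,
    integral_firstProb_opMarginal] at hpos
  rw [integral_pi_two ν i (fun p => firstProb p a) (fun p => firstProb p o),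
    integral_pi_two ν i (fun p => firstProb p a * secondProb p a o b) (fun p => firstProb p o), hi,
    integral_firstProb_opMarginal, integral_first_mul_second_opMarginal]
  -- The other agent enters numerator and denominator through the same factor, nonzero since the
  -- history is reached; this is why the witness does not matter.
  rw [mul_div_mul_right _ _ (right_ne_zero_of_mul hpos.ne')]
  ring

theorem condPlay_empty (π : leverGame.Policy) (i b : Fin 2)
    (ν : ∀ j, ProbabilityMeasure (leverGame.LocalPolicy j))
    (hν : leverGame.Witness i ((leverGame.opDist π).map fun π' => π' i) (emptyHist i) ν) :
    leverGame.condPlay i ν (emptyHist i) b = 1 / 2 := by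
  have hi : ν i = opMarginal π i := Subtype.ext hν.1
  unfold condPlay mixProb
  simp only [prob_reach_empty, prob_plays_inter_reach_empty]
  have h := integral_pi_two ν i (fun p => firstProb p b) 1
  simp only [Pi.one_apply, mul_one] at h
  rw [h, hi, integral_firstProb_opMarginal]
  simp

/-- Drawing the other agent's policy from its own other-play marginal works: both first actions are
then uniform, so each one-step history has probability `1/4`. The uniform default of the symmetrizer
never occurs. -/
theorem exists_witness (π : leverGame.Policy) (i : Fin 2) (τ : leverGame.AOHist i) :
    ∃ ν, leverGame.Witness i ((leverGame.opDist π).map fun π' => π' i) τ ν := by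
  refine ⟨opMarginal π, rfl, ?_⟩
  unfold mixProb
  obtain rfl | ⟨a, o, rfl⟩ := hist_cases i τ
  · simp only [prob_reach_empty]
    simp
  · simp only [prob_reach_one]
    rw [integral_pi_two (opMarginal π) i (fun p => firstProb p a) (fun p => firstProb p o),
      integral_firstProb_opMarginal, integral_firstProb_opMarginal]
    norm_num

/-- Equivalence of policies in a problem isomorphic to the lever game. -/
theorem push_mem_opClass_push_iff {E : DecPOMDP} (f : Iso leverGame E) (π π' : leverGame.Policy) :
    f.push π ∈ E.opClass (f.push π') ↔
      repeatBias π = repeatBias π' ∧ failBias π = failBias π' := by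
  have hone : ∀ (π : leverGame.Policy) (i a o b : Fin 2),
      E.symmetrizer (f.push π) (f.fN i) (f.mapHist i (oneHist i a o)) (f.fA i b)
        = symSecond π a o b := fun π i a o b =>
    f.symmetrizer_push π i _ b (exists_witness π i _) fun ν hν => condPlay_one π i a o b ν hν
  have hempty : ∀ (π : leverGame.Policy) (i b : Fin 2),
      E.symmetrizer (f.push π) (f.fN i) (f.mapHist i (emptyHist i)) (f.fA i b)
        = 1 / 2 := fun π i b =>
    f.symmetrizer_push π i _ b (exists_witness π i _) fun ν hν => condPlay_empty π i b ν hν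
  constructor
  · intro h
    have h' : ∀ a o : Fin 2, symSecond π a o 0 = symSecond π' a o 0 := fun a o => by
      rw [← hone π 0 a o 0, ← hone π' 0 a o 0]
      exact congrFun (congrFun (congrFun h (f.fN (0 : Fin 2))) _) _
    simp only [symSecond, if_true, add_right_inj] at h'
    -- The biases are read off from the second-round probability of lever `0` after successful and
    -- after failed coordination.
    exact ⟨h' 0 0, h' 0 1⟩
  · rintro ⟨hr, hf⟩
    have hs : ∀ c, symFeature π c = symFeature π' c := fun c => by
      rw [symFeature_eq_of_bias (π' := π') (t := 1) (by rw [hr, one_mul]) (by rw [hf, one_mul]),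
        one_mul]
    change E.symmetrizer (f.push π) = E.symmetrizer (f.push π')
    funext j τ b
    obtain ⟨i, rfl⟩ := f.fN.surjective j
    change Fin 2 at i
    obtain ⟨b, rfl⟩ := (f.fA i).surjective b
    rw [← f.mapHist_invHist i τ]
    obtain hτ | ⟨a, o, hτ⟩ := hist_cases i (f.invHist i τ)
    · rw [hτ]
      exact (hempty π i b).trans (hempty π' i b).symm
    · rw [hτ]
      refine (hone π i a o b).trans (Eq.trans ?_ (hone π' i a o b).symm)
      simp only [symSecond, hs]

theorem mem_opClass_iff (π π' : leverGame.Policy) :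
    π ∈ leverGame.opClass π' ↔ repeatBias π = repeatBias π' ∧ failBias π = failBias π' := by
  have h : ∀ π, (leverAut 1 1).push π = π := fun π => funext fun i => leverAut_push_one 1 π i
  rw [← push_mem_opClass_push_iff (leverAut 1 1), h, h]

/-! ### The two optimal classes -/

theorem firstProb_leverPolicy (r : Fin 2 → Fin 2) (i b : Fin 2) :
    firstProb (leverPolicy r i) b = 1 / 2 := rfl

theorem secondProb_leverPolicy (r : Fin 2 → Fin 2) (i a o b : Fin 2) :
    secondProb (leverPolicy r i) a o b
      = if a = o then (if b = r a then 1 else 0) else 1 / 2 := by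
  have h : leverPolicy r i (oneHist 0 a o)
      = if a = o then pointDist (r a) else uniformLever := rfl
  change (leverPolicy r i (oneHist 0 a o) : Fin 2 → ℝ) b = _
  rw [h]
  split_ifs with h1 h2
  · exact (pointDist_apply _ _).trans (if_pos h2)
  · exact (pointDist_apply _ _).trans (if_neg h2)
  · rfl

theorem repeatBias_policyR : repeatBias policyR = 1 / 2 := by
  simp only [repeatBias, symFeature, feature, firstProb_flipLocal, secondProb_flipLocal, policyR,
    firstProb_leverPolicy, secondProb_leverPolicy, rev_zero_two, rev_one_two, id]
  norm_num

theorem failBias_policyR : failBias policyR = 0 := by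
  simp only [failBias, symFeature, feature, firstProb_flipLocal, secondProb_flipLocal, policyR,
    firstProb_leverPolicy, secondProb_leverPolicy, rev_zero_two, rev_one_two, id]
  norm_num

theorem repeatBias_policyS : repeatBias policyS = -1 / 2 := by
  simp only [repeatBias, symFeature, feature, firstProb_flipLocal, secondProb_flipLocal, policyS,
    firstProb_leverPolicy, secondProb_leverPolicy, rev_zero_two, rev_one_two]
  norm_num

theorem failBias_policyS : failBias policyS = 0 := by
  simp only [failBias, symFeature, feature, firstProb_flipLocal, secondProb_flipLocal, policyS,
    firstProb_leverPolicy, secondProb_leverPolicy, rev_zero_two, rev_one_two]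
  norm_num

theorem mem_opClass_policyR_iff (π : leverGame.Policy) :
    π ∈ leverGame.opClass policyR ↔ repeatBias π = 1 / 2 ∧ failBias π = 0 := by
  rw [mem_opClass_iff, repeatBias_policyR, failBias_policyR]

theorem mem_opClass_policyS_iff (π : leverGame.Policy) :
    π ∈ leverGame.opClass policyS ↔ repeatBias π = -1 / 2 ∧ failBias π = 0 := by
  rw [mem_opClass_iff, repeatBias_policyS, failBias_policyS]

theorem opClass_policyR_ne_opClass_policyS :
    leverGame.opClass policyR ≠ leverGame.opClass policyS := by
  intro h
  have h1 : policyR ∈ leverGame.opClass policyS := by rw [← h]; exact rfl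
  rw [mem_opClass_policyS_iff, repeatBias_policyR] at h1
  norm_num at h1

theorem JOP_policyR : leverGame.JOP policyR = 1 / 2 :=
  (JOP_eq_half_iff _).2 (Or.inl ⟨repeatBias_policyR, failBias_policyR⟩)

theorem mem_union_opClass_iff (π : leverGame.Policy) :
    π ∈ leverGame.opClass policyR ∪ leverGame.opClass policyS ↔ leverGame.JOP π = 1 / 2 := by
  rw [Set.mem_union, mem_opClass_policyR_iff, mem_opClass_policyS_iff, JOP_eq_half_iff]

theorem isOPOptimal_iff (π : leverGame.Policy) :
    leverGame.IsOPOptimal π ↔ leverGame.JOP π = 1 / 2 :=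
  ⟨fun h => le_antisymm (JOP_le π) (JOP_policyR ▸ h policyR), fun h π' => h ▸ JOP_le π'⟩

theorem J_policyR_policyS :
    leverGame.J (fun i => if i = 0 then policyR i else policyS i) = -1 / 2 := by
  rw [J_eq]
  change ∑ c, feature (leverPolicy id 0) c * feature (leverPolicy Fin.rev 1) (swapIdx c) = _
  simp only [sum_option_two, swapIdx, Option.map, Prod.swap, feature, firstProb_leverPolicy,
    secondProb_leverPolicy, rev_zero_two, rev_one_two, id]
  norm_num

theorem J_policyS_policyR :
    leverGame.J (fun i => if i = 0 then policyS i else policyR i) = -1 / 2 := by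
  rw [J_eq]
  change ∑ c, feature (leverPolicy Fin.rev 0) c * feature (leverPolicy id 1) (swapIdx c) = _
  simp only [sum_option_two, swapIdx, Option.map, Prod.swap, feature, firstProb_leverPolicy,
    secondProb_leverPolicy, rev_zero_two, rev_one_two, id]
  norm_num

/-! ### Label-free coordination -/

/-- Measurability of `s` is not required: the measurable set where `G = c` contains `s`, hence also
has full measure. It is applied to the classes pushed to relabeled problems. -/
theorem ae_eq_of_measure_eq_one {X : Type*} [MeasurableSpace X] {μ : Measure X}
    [IsProbabilityMeasure μ] {s : Set X} (hs : μ s = 1) {G : X → ℝ} (hG : Measurable G) {c : ℝ}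
    (h : ∀ x ∈ s, G x = c) : ∀ᵐ x ∂μ, G x = c := by
  have hm : MeasurableSet {x | G x = c} := hG (measurableSet_singleton c)
  exact (mem_ae_iff_prob_eq_one hm).2 (le_antisymm prob_le_one (hs ▸ measure_mono h))

/-- The average of a feature of agent `i` over the isomorphisms to the lever game. -/
noncomputable def avgFeature (E : DecPOMDP) (i : Fin 2) (c : Option (Fin 2 × Fin 2))
    (ρ : E.Policy) : ℝ :=
  𝔼 h : Iso E leverGame, feature (h.push ρ i) c

theorem measurable_feature_push {E : DecPOMDP} (h : Iso E leverGame) (i : Fin 2)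
    (c : Option (Fin 2 × Fin 2)) : Measurable fun ρ : E.Policy => feature (h.push ρ i) c :=
  (measurable_feature c).comp ((measurable_pi_apply i).comp h.measurable_push)

theorem measurable_avgFeature (E : DecPOMDP) (i : Fin 2) (c : Option (Fin 2 × Fin 2)) :
    Measurable (avgFeature E i c) := by
  unfold avgFeature
  simp only [Fintype.expect_eq_sum_div_card]
  exact (Finset.measurable_sum _ fun h _ => measurable_feature_push h i c).div_const _

theorem integrable_feature_push {E : DecPOMDP} (h : Iso E leverGame) (i : Fin 2)
    (c : Option (Fin 2 × Fin 2)) (μ : Measure E.Policy) [IsFiniteMeasure μ] :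
    Integrable (fun ρ : E.Policy => feature (h.push ρ i) c) μ :=
  Integrable.of_bound (measurable_feature_push h i c).aestronglyMeasurable 1
    (Filter.Eventually.of_forall fun _ => abs_feature_le _ _)

theorem expect_integral_feature (E : DecPOMDP) (i : Fin 2) (c : Option (Fin 2 × Fin 2))
    (μ : Measure E.Policy) [IsFiniteMeasure μ] :
    𝔼 h : Iso E leverGame, ∫ ρ, feature (h.push ρ i) c ∂μ = ∫ ρ, avgFeature E i c ρ ∂μ := by
  unfold avgFeature
  simp only [Fintype.expect_eq_sum_div_card]
  rw [integral_div, integral_finsetSum _ fun h _ => integrable_feature_push h i c μ]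

/-- Precomposing with `f` turns the isomorphisms from `E` to the game into its automorphisms, each
exactly once, so the average does not depend on `f`. -/
theorem avgFeature_push {E : DecPOMDP} (f : Iso leverGame E) (i : Fin 2)
    (c : Option (Fin 2 × Fin 2)) (π : leverGame.Policy) :
    avgFeature E i c (f.push π) = symFeature π c := by
  rw [← expect_feature π i c, avgFeature]
  exact Fintype.expect_bijective _ f.trans_left_bijective _ _ fun h => by rw [f.push_trans]

theorem avgFeature_of_mem_pushClass {E : DecPOMDP} (f : Iso leverGame E) (i : Fin 2)
    (c : Option (Fin 2 × Fin 2)) {ρ : E.Policy} {π : leverGame.Policy}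
    (h : ρ ∈ f.pushClass π) : avgFeature E i c ρ = symFeature π c := by
  obtain ⟨π', rfl⟩ := f.push_surjective ρ
  obtain ⟨hr, hf⟩ := (push_mem_opClass_push_iff f π' π).1 h
  rw [avgFeature_push, symFeature_eq_of_bias (π' := π) (t := 1) (by rw [hr, one_mul])
    (by rw [hf, one_mul]), one_mul]

theorem JOP_of_mem_pushClass {E : DecPOMDP} (f : Iso leverGame E) {ρ : E.Policy}
    {π : leverGame.Policy} (h : ρ ∈ f.pushClass π) : E.JOP ρ = leverGame.JOP π := by
  obtain ⟨π', rfl⟩ := f.push_surjective ρ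
  obtain ⟨hr, hf⟩ := (push_mem_opClass_push_iff f π' π).1 h
  rw [f.JOP_push, JOP_eq, JOP_eq, hr, hf]

/-- The two joint policies are drawn independently and agent `k` uses only its part of the `k`-th
one, so each product of features integrates to a product of integrals. -/
theorem integral_J_pi (μ : Fin 2 → Measure leverGame.Policy) [∀ k, IsProbabilityMeasure (μ k)] :
    ∫ π : Fin 2 → leverGame.Policy, leverGame.J (fun l => π l l) ∂(Measure.pi μ)
      = ∑ c, (∫ π, feature (π 0) c ∂(μ 0)) * ∫ π, feature (π 1) (swapIdx c) ∂(μ 1) := by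
  simp only [J_eq]
  rw [integral_finsetSum]
  · refine Finset.sum_congr rfl fun c _ => ?_
    have h := integral_fintype_prod_eq_prod (𝕜 := ℝ)
      (fun (k : Fin 2) (π : leverGame.Policy) => feature (π k) (if k = 0 then c else swapIdx c))
      (μ := μ)
    simp only [Fin.prod_univ_two, if_true, one_ne_zero, if_false] at h
    exact h
  · intro c _
    have hm : ∀ (k : Fin 2) c, Measurable fun π : Fin 2 → leverGame.Policy => feature (π k k) c :=
      fun k c => (measurable_feature c).comp ((measurable_pi_apply k).comp (measurable_pi_apply k))
    refine Integrable.of_bound ((hm 0 c).mul (hm 1 (swapIdx c))).aestronglyMeasurable 1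
      (Filter.Eventually.of_forall fun π => ?_)
    rw [Real.norm_eq_abs, abs_mul]
    exact mul_le_one₀ (abs_feature_le _ _) (abs_nonneg _) (abs_feature_le _ _)

/-- The value in the label-free coordination problem in terms of averaged features. -/
theorem lfcValue_eq (σ : LearningAlg leverGame.relabelings) :
    leverGame.lfcValue σ = ∑ c,
      (𝔼 E : leverGame.relabelings, ∫ ρ, avgFeature E 0 c ρ ∂(σ E : Measure (Policy (E : DecPOMDP))))
        * 𝔼 E : leverGame.relabelings,
          ∫ ρ, avgFeature E 1 (swapIdx c) ρ ∂(σ E : Measure (Policy (E : DecPOMDP))) := by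
  have hinner : ∀ (E : Fin 2 → leverGame.relabelings)
      (f : ∀ j, Iso (E j : DecPOMDP) leverGame),
      ∫ π : Fin 2 → leverGame.Policy, leverGame.J (fun l => π l l)
        ∂(Measure.pi fun k => (σ (E k) : Measure (Policy (E k : DecPOMDP))).map (f k).push)
      = ∑ c, (∫ ρ, feature ((f 0).push ρ 0) c ∂(σ (E 0) : Measure (Policy (E 0 : DecPOMDP))))
        * ∫ ρ, feature ((f 1).push ρ 1) (swapIdx c)
            ∂(σ (E 1) : Measure (Policy (E 1 : DecPOMDP))) := by
    intro E f
    have : ∀ k, IsProbabilityMeasure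
        ((σ (E k) : Measure (Policy (E k : DecPOMDP))).map (f k).push) := fun k =>
      Measure.isProbabilityMeasure_map (f k).measurable_push.aemeasurable
    have hm : ∀ (k : Fin 2) c, Measurable fun π : leverGame.Policy => feature (π k) c :=
      fun k c => (measurable_feature c).comp (measurable_pi_apply k)
    rw [integral_J_pi]
    refine Finset.sum_congr rfl fun c _ => ?_
    rw [integral_map (f 0).measurable_push.aemeasurable (hm 0 c).aestronglyMeasurable,
      integral_map (f 1).measurable_push.aemeasurable (hm 1 (swapIdx c)).aestronglyMeasurable]
  -- The isomorphisms are independent given the relabeled problems, so averaging over them acts on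
  -- each factor separately; the relabeled problems are averaged out afterwards in the same way.
  have hmid : ∀ E : Fin 2 → leverGame.relabelings,
      (𝔼 f : ∀ j, Iso (E j : DecPOMDP) leverGame,
        ∑ c, (∫ ρ, feature ((f 0).push ρ 0) c ∂(σ (E 0) : Measure (Policy (E 0 : DecPOMDP))))
          * ∫ ρ, feature ((f 1).push ρ 1) (swapIdx c)
              ∂(σ (E 1) : Measure (Policy (E 1 : DecPOMDP))))
      = ∑ c, (∫ ρ, avgFeature (E 0) 0 c ρ ∂(σ (E 0) : Measure (Policy (E 0 : DecPOMDP))))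
          * ∫ ρ, avgFeature (E 1) 1 (swapIdx c) ρ
              ∂(σ (E 1) : Measure (Policy (E 1 : DecPOMDP))) := by
    intro E
    rw [Finset.expect_sum_comm]
    refine Finset.sum_congr rfl fun c _ => ?_
    have h := expect_pi_two (A := fun j => Iso (E j : DecPOMDP) leverGame)
      (fun k g => ∫ ρ, feature (g.push ρ k) (if k = 0 then c else swapIdx c)
        ∂(σ (E k) : Measure (Policy (E k : DecPOMDP))))
    simp only [if_true, one_ne_zero, if_false] at h
    rw [expect_integral_feature, expect_integral_feature] at h
    exact h
  unfold lfcValue lfcPayoff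
  refine (Finset.expect_congr rfl fun E _ => (Finset.expect_congr rfl fun f _ =>
    hinner E f).trans (hmid E)).trans ?_
  rw [Finset.expect_sum_comm]
  refine Finset.sum_congr rfl fun c _ => ?_
  have h := expect_pi_two (A := fun _ => leverGame.relabelings)
    (fun k E => ∫ ρ, avgFeature E k (if k = 0 then c else swapIdx c) ρ
      ∂(σ E : Measure (Policy (E : DecPOMDP))))
  simp only [if_true, one_ne_zero, if_false] at h
  exact h

/-- If the averaged features of the learned policies are multiples of those of `policyR`, then
the value is half the square of the average multiple. -/
theorem lfcValue_of_forall_integral (σ : LearningAlg leverGame.relabelings)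
    (t : leverGame.relabelings → ℝ)
    (h : ∀ (E : leverGame.relabelings) (i : Fin 2) (c : Option (Fin 2 × Fin 2)),
      ∫ ρ, avgFeature E i c ρ ∂(σ E : Measure (Policy (E : DecPOMDP)))
        = t E * symFeature policyR c) :
    leverGame.lfcValue σ = (𝔼 E, t E) ^ 2 / 2 := by
  have hsum := sum_symFeature_mul policyR policyR
  rw [repeatBias_policyR, failBias_policyR] at hsum
  rw [lfcValue_eq]
  simp only [h, ← Finset.expect_mul]
  calc ∑ c, (𝔼 E, t E) * symFeature policyR c * ((𝔼 E, t E) * symFeature policyR (swapIdx c))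
      = (𝔼 E, t E) ^ 2 * ∑ c, symFeature policyR c * symFeature policyR (swapIdx c) := by
        rw [Finset.mul_sum]
        exact Finset.sum_congr rfl fun c _ => by ring
    _ = _ := by rw [hsum]; ring

/-- The learning algorithm that always learns the same policy of the lever game. -/
noncomputable def pushAlg (f : ∀ E : leverGame.relabelings, Iso leverGame (E : DecPOMDP))
    (π : leverGame.Policy) : LearningAlg leverGame.relabelings :=
  fun E => ⟨Measure.dirac ((f E).push π), inferInstance⟩

/-- The competitor that refutes optimality: committing to one class on every relabeled problem makes
all multiples equal to `1`. -/
theorem lfcValue_pushAlg_policyR (f : ∀ E : leverGame.relabelings, Iso leverGame (E : DecPOMDP))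
    [Nonempty leverGame.relabelings] :
    leverGame.lfcValue (pushAlg f policyR) = 1 / 2 := by
  rw [lfcValue_of_forall_integral _ fun _ => 1]
  · rw [Fintype.expect_const]; norm_num
  · intro E i c
    change ∫ ρ, avgFeature E i c ρ ∂(Measure.dirac ((f E).push policyR)) = _
    rw [integral_dirac_measurable (measurable_avgFeature _ i c), avgFeature_push, one_mul]

theorem isOPAlg_of_forall_ae {σ : LearningAlg leverGame.relabelings}
    (f : ∀ E : leverGame.relabelings, Iso leverGame (E : DecPOMDP))
    (h : ∀ E : leverGame.relabelings, ∀ᵐ ρ ∂(σ E : Measure (Policy (E : DecPOMDP))),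
      JOP (E : DecPOMDP) ρ = 1 / 2) : IsOPAlg σ := by
  intro E
  rw [integral_congr_ae (h E), integral_const]
  simp only [probReal_univ, one_smul]
  refine ⟨⟨(f E).push policyR, by rw [(f E).JOP_push, JOP_policyR]⟩, ?_⟩
  rintro _ ⟨ρ, rfl⟩
  obtain ⟨π, rfl⟩ := (f E).push_surjective ρ
  rw [(f E).JOP_push]
  exact JOP_le π

/-! ### Algorithms that learn both classes -/

/-- One index with positive weight keeps the mean above `-1`, one with weight below `1` keeps it
below `1`; the two may differ. -/
theorem expect_sq_lt_one {ι : Type*} [Fintype ι] {α : ι → ℝ} (hα : ∀ x, α x ∈ Set.Icc (0 : ℝ) 1)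
    (h0 : ∃ x, 0 < α x) (h1 : ∃ x, α x < 1) : (𝔼 x, (2 * α x - 1)) ^ 2 < 1 := by
  obtain ⟨x, hx⟩ := h0
  obtain ⟨y, hy⟩ := h1
  have : Nonempty ι := ⟨x⟩
  have hc : (0 : ℝ) < Fintype.card ι := Nat.cast_pos.2 Fintype.card_pos
  have hlt : ∑ x, (2 * α x - 1) < ∑ _x : ι, (1 : ℝ) :=
    Finset.sum_lt_sum (fun z _ => by linarith [(hα z).2]) ⟨y, Finset.mem_univ _, by linarith⟩
  have hgt : ∑ _x : ι, (-1 : ℝ) < ∑ x, (2 * α x - 1) :=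
    Finset.sum_lt_sum (fun z _ => by linarith [(hα z).1]) ⟨x, Finset.mem_univ _, by linarith⟩
  simp only [Finset.sum_const, Finset.card_univ, nsmul_eq_mul, mul_one, mul_neg] at hlt hgt
  rw [sq_lt_one_iff_abs_lt_one, Fintype.expect_eq_sum_div_card, abs_lt, lt_div_iff₀ hc,
    div_lt_iff₀ hc]
  exact ⟨by linarith, by linarith⟩

/-- The averaged feature is almost surely constant on each component, with opposite values for the
two classes, so the weights combine to `α - (1 - α)`. -/
theorem integral_of_mixture {E : DecPOMDP} (f : Iso leverGame E) {α : ℝ}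
    (hα : α ∈ Set.Icc (0 : ℝ) 1) {μ μ' : Measure E.Policy} [IsProbabilityMeasure μ]
    [IsProbabilityMeasure μ'] (hμ : μ (f.pushClass policyR) = 1)
    (hμ' : μ' (f.pushClass policyS) = 1) (i : Fin 2) (c : Option (Fin 2 × Fin 2)) :
    ∫ ρ, avgFeature E i c ρ ∂(ENNReal.ofReal α • μ + ENNReal.ofReal (1 - α) • μ')
      = (2 * α - 1) * symFeature policyR c := by
  have hm := measurable_avgFeature E i c
  have h : ∀ᵐ ρ ∂μ, avgFeature E i c ρ = symFeature policyR c :=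
    ae_eq_of_measure_eq_one hμ hm fun ρ hρ => avgFeature_of_mem_pushClass f i c hρ
  have h' : ∀ᵐ ρ ∂μ', avgFeature E i c ρ = -symFeature policyR c :=
    ae_eq_of_measure_eq_one hμ' hm fun ρ hρ => by
      rw [avgFeature_of_mem_pushClass f i c hρ, symFeature_eq_of_bias (π' := policyR) (t := -1)
        (by rw [repeatBias_policyS, repeatBias_policyR]; norm_num)
        (by rw [failBias_policyS, failBias_policyR]; norm_num), neg_one_mul]
  have hi : Integrable (avgFeature E i c) μ :=
    (integrable_congr h).2 (integrable_const _)
  have hi' : Integrable (avgFeature E i c) μ' :=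
    (integrable_congr h').2 (integrable_const _)
  rw [integral_add_measure (hi.smul_measure ENNReal.ofReal_ne_top)
    (hi'.smul_measure ENNReal.ofReal_ne_top), integral_smul_measure, integral_smul_measure,
    integral_congr_ae h, integral_congr_ae h', integral_const, integral_const,
    ENNReal.toReal_ofReal hα.1, ENNReal.toReal_ofReal (sub_nonneg.2 hα.2)]
  simp only [probReal_univ, smul_eq_mul]
  ring

theorem isOPAlg_of_learnsBoth
    {f : ∀ E : leverGame.relabelings, Iso leverGame (E : DecPOMDP)}
    {σ : LearningAlg leverGame.relabelings}
    (h : leverGame.LearnsBoth policyR policyS f σ) : IsOPAlg σ := by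
  obtain ⟨α, μ, μ', -, hσ, hμ, hμ', -, -⟩ := h
  refine isOPAlg_of_forall_ae f fun E => ?_
  have hS : leverGame.JOP policyS = 1 / 2 :=
    (JOP_eq_half_iff _).2 (Or.inr ⟨repeatBias_policyS, failBias_policyS⟩)
  rw [hσ E, ae_add_measure_iff]
  exact ⟨Measure.ae_smul_measure (ae_eq_of_measure_eq_one (hμ E) (measurable_JOP _) fun ρ hρ =>
      (JOP_of_mem_pushClass (f E) hρ).trans JOP_policyR) _,
    Measure.ae_smul_measure (ae_eq_of_measure_eq_one (hμ' E) (measurable_JOP _) fun ρ hρ =>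
      (JOP_of_mem_pushClass (f E) hρ).trans hS) _⟩

theorem lfcValue_lt_of_learnsBoth
    {f : ∀ E : leverGame.relabelings, Iso leverGame (E : DecPOMDP)}
    {σ : LearningAlg leverGame.relabelings}
    (h : leverGame.LearnsBoth policyR policyS f σ) : leverGame.lfcValue σ < 1 / 2 := by
  obtain ⟨α, μ, μ', hα, hσ, hμ, hμ', h0, h1⟩ := h
  rw [lfcValue_of_forall_integral σ fun E => 2 * α E - 1]
  · linarith [expect_sq_lt_one hα h0 h1]
  · intro E i c
    rw [hσ E]
    exact integral_of_mixture (f E) (hα E) (hμ E) (hμ' E) i c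

end LeverGame

open LeverGame in
theorem mainTheorem2 :
    -- the OP-optimal policies form exactly two classes, both of OP value `1/2`
    (leverGame.opClass policyR ≠ leverGame.opClass policyS ∧
      (∀ π : leverGame.Policy, leverGame.IsOPOptimal π ↔
        π ∈ leverGame.opClass policyR ∪ leverGame.opClass policyS) ∧
      (∀ π ∈ leverGame.opClass policyR ∪ leverGame.opClass policyS,
        leverGame.JOP π = 1 / 2)) ∧
    -- cross-play values
    (leverGame.J (fun i => if i = 0 then policyR i else policyS i) = -1 / 2 ∧
      leverGame.J (fun i => if i = 0 then policyS i else policyR i) = -1 / 2) ∧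
    -- learning both classes
    (∀ (f : ∀ E : leverGame.relabelings, DecPOMDP.Iso leverGame (E : DecPOMDP))
      (σ : DecPOMDP.LearningAlg leverGame.relabelings),
      leverGame.LearnsBoth policyR policyS f σ →
        DecPOMDP.IsOPAlg σ ∧ leverGame.lfcValue σ < 1 / 2 ∧ ¬ leverGame.IsLFCOptimal σ) := by
  refine ⟨⟨opClass_policyR_ne_opClass_policyS, fun π => ?_, fun π hπ => ?_⟩,
    ⟨J_policyR_policyS, J_policyS_policyR⟩, fun f σ h => ?_⟩
  · rw [isOPOptimal_iff, mem_union_opClass_iff]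
  · exact (mem_union_opClass_iff π).1 hπ
  · refine ⟨isOPAlg_of_learnsBoth h, lfcValue_lt_of_learnsBoth h, fun hopt => ?_⟩
    -- Needed for the uniform average of `1` to be `1`; the hypothesis already exhibits a relabeled
    -- problem.
    have : Nonempty leverGame.relabelings := by
      obtain ⟨α, μ, μ', -, -, -, -, ⟨E, -⟩, -⟩ := h
      exact ⟨E⟩
    exact absurd (lfcValue_pushAlg_policyR f ▸ hopt (pushAlg f policyR))
      (not_le.2 (lfcValue_lt_of_learnsBoth h))
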